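/- Let $N \ge 2$ and let $B_r(x)$ denote the open ball in $\mathbb{R}^N$ with radius $r$ and center $x$, and $B_r = B_r(0)$. Let $h \in \mathbb{R}\cup\{+\infty\}$ with $h \neq 0$, let $0<\alpha<\beta$, and let $x_0\in\mathbb{R}^N$ be such that $\overline{B_\alpha(x_0)} \subset B_\beta$. For $\Omega = B_\beta \setminus \overline{B_\alpha(x_0)}$ denote by $$ \tau_1(\Omega) = \inf\left\{ \frac{\int_\Omega |\nabla u|^2\,dx + h\int_{\partial B_\alpha(x_0)} u^2\,dS}{\int_\Omega u^2\,dx} : u \in \tilde H^1(\Omega)\setminus\{0\} \right\} $$ the first eigenvalue of the Laplacian $-\Delta$ in $\Omega$ with the Robin condition $\frac{\partial u}{\partial\eta} + hu = 0$ on the inner sphere $\partial B_\alpha(x_0)$ ($\eta$ is the outward unit normal to $\partial\Omega$; for $h=+\infty$ the Dirichlet condition $u=0$) and the Neumann condition $\frac{\partial u}{\partial \eta} = 0$ on $\partial B_\beta$. Here $\tilde H^1(\Omega) = H^1(\Omega)$ if $h<+\infty$, while for $h=+\infty$ one takes $\tilde H^1(\Omega)=\{u\in H^1(\Omega): u = 0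 \text{ on } \partial B_\alpha(x_0) \text{ in the sense of traces}\}$ and the boundary term is understood as $0$. Then $$ \tau_1\big(B_\beta \setminus \overline{B_\alpha(x_0)}\big) \le \tau_1\big(B_\beta \setminus \overline{B_\alpha}\big), $$ and equality holds if and only if $x_0 = 0$. -/

import Mathlib

open MeasureTheory Filter Topology

noncomputable section

namespace RobinShell

/-- The Euclidean space `ℝ^N`. -/
abbrev Space (N : ℕ) : Type := EuclideanSpace ℝ (Fin N)

/-- `w` is the weak (distributional) gradient of `u` in `Ω`:
`∫_Ω u ∇φ = - ∫_Ω φ w` for every test function `φ ∈ C_c^∞(Ω)`. -/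
def HasWeakGradient {N : ℕ} (Ω : Set (Space N)) (u : Space N → ℝ)
    (w : Space N → Space N) : Prop :=
  ∀ φ : Space N → ℝ, ContDiff ℝ (⊤ : ℕ∞) φ → HasCompactSupport φ → tsupport φ ⊆ Ω →
    ∫ x in Ω, u x • gradient φ x = - ∫ x in Ω, φ x • w x

/-- `u` belongs to the Sobolev space `H¹(Ω)`, with weak gradient `∇u = w`. -/
structure MemH1 {N : ℕ} (Ω : Set (Space N)) (u : Space N → ℝ)
    (w : Space N → Space N) : Prop where
  memLp : MemLp u 2 (volume.restrict Ω)
  memLp_grad : MemLp w 2 (volume.restrict Ω)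
  hasWeakGradient : HasWeakGradient Ω u w

/-- The surface measure `dS` on the sphere `∂B_r(c)`, as a measure on `ℝ^N` concentrated on that
sphere: `r^(N-1)` times the image under `s ↦ c + r s` of the surface measure of the unit sphere. -/
def surfaceMeasure {N : ℕ} (c : Space N) (r : ℝ) : Measure (Space N) :=
  ENNReal.ofReal (r ^ (N - 1)) •
    ((volume : Measure (Space N)).toSphere).map
      (fun s : Metric.sphere (0 : Space N) 1 => c + r • (s : Space N))

/-- `g ∈ L²(∂B_r(c))` is the trace on the sphere `∂B_r(c)` of the function `u ∈ H¹(Ω)` with weak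
gradient `w`: some sequence of functions that are `C¹` up to the boundary converges to `u` in
`H¹(Ω)`, and the restrictions of these functions to the sphere converge to `g` in `L²(∂B_r(c))`.
If `Ω` is a bounded Lipschitz domain and the sphere is a part of `∂Ω`, then every `u ∈ H¹(Ω)` has
exactly one trace in this sense (up to null sets), namely the usual one. -/
structure IsTraceOnSphere {N : ℕ} (Ω : Set (Space N)) (c : Space N) (r : ℝ)
    (u : Space N → ℝ) (w : Space N → Space N) (g : Space N → ℝ) : Prop where
  memLp : MemLp g 2 (surfaceMeasure c r)
  exists_approx : ∃ φ : ℕ → Space N → ℝ, (∀ n, ContDiff ℝ 1 (φ n)) ∧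
    Tendsto (fun n => eLpNorm (φ n - u) 2 (volume.restrict Ω)) atTop (𝓝 0) ∧
    Tendsto (fun n => eLpNorm (gradient (φ n) - w) 2 (volume.restrict Ω)) atTop (𝓝 0) ∧
    Tendsto (fun n => eLpNorm (φ n - g) 2 (surfaceMeasure c r)) atTop (𝓝 0)

/-- The set of values of the Rayleigh quotient
`(∫_Ω |∇u|² dx + h ∫_{∂B_r(c)} u² dS) / ∫_Ω u² dx`
over all nonzero `u ∈ H¹(Ω)` if `h` is finite, and over all nonzero `u ∈ H¹(Ω)` with zero trace on
`∂B_r(c)` if `h = +∞`, the boundary term being zero in the latter case. -/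
def rayleighValues {N : ℕ} (h : WithTop ℝ) (Ω : Set (Space N)) (c : Space N) (r : ℝ) : Set ℝ :=
  {q | ∃ (u : Space N → ℝ) (w : Space N → Space N) (g : Space N → ℝ),
    MemH1 Ω u w ∧ IsTraceOnSphere Ω c r u w g ∧
    ¬ (u =ᵐ[volume.restrict Ω] 0) ∧
    (h = ⊤ → g =ᵐ[surfaceMeasure c r] 0) ∧
    q = ((∫ x in Ω, ‖w x‖ ^ 2) + h.untopD 0 * ∫ x, g x ^ 2 ∂(surfaceMeasure c r)) /
      ∫ x in Ω, u x ^ 2}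

/-- The first eigenvalue `τ₁(Ω)` of the Laplacian in `Ω = Ω_out \ closure (B_r(c))` with the Robin
condition `∂u/∂η + h u = 0` on `∂B_r(c)` (the Dirichlet condition `u = 0` if `h = +∞`) and the
Neumann condition on `∂Ω_out`, given by its variational characterization. The infimum is taken in
the extended reals, so no convention for unbounded sets of reals enters. -/
def firstEigenvalue {N : ℕ} (h : WithTop ℝ) (Ω : Set (Space N)) (c : Space N) (r : ℝ) : EReal :=
  sInf ((fun q : ℝ => (q : EReal)) '' rayleighValues h Ω c r)

/-- The (possibly eccentric) spherical shell `B_β \ closure (B_α(x₀))`, where `B_β` is centered at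
the origin. -/
def shell {N : ℕ} (β α : ℝ) (x₀ : Space N) : Set (Space N) :=
  Metric.ball 0 β \ closure (Metric.ball x₀ α)

end RobinShell

end

/-! Let `τ` be the first eigenvalue of the concentric shell and `f` its radial eigenfunction,
normalised by `f β = 1`, `f' β = 0` and continued by `1` beyond `β`. Transplant it to `u x = f ‖x -
x₀‖` and compare `Ω = B_β \ B_α(x₀)` with `A = B_β(x₀) \ B_α(x₀)`. On `A` the energy with boundary
term equals `τ ∫_A u²`. On `Ω \ A` one has `u = 1` and `∇u = 0`; on `A \ Ω` one has `τ (u² - 1) <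
0`, whatever the sign of `τ`. As `A \ Ω` and `Ω \ A` have equal volume, passing from `A` to `Ω` does
not raise the energy and raises `τ ∫ u²`, strictly when `x₀ ≠ 0`. So the Rayleigh quotient of `u` is
below `τ` (`exists_rayleighValue_lt`).

Conversely, `τ` bounds every Rayleigh quotient of the concentric shell from below
(`exists_radial_eigenfunction`). Picone's inequality along each ray gives this for `C¹` functions,
and approximation gives it for Sobolev functions with their traces.

The pair `(τ, f)` comes from shooting: the solution of the radial equation with the data at `β` is a
power series in `-τ`, and `τ` is found by the intermediate value theorem from the condition at `α`.
-/

noncomputable section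
namespace RobinShell

/-- `f` solves `(ρ f')' = -τ ρ f` on `[α, β]` with `f β = 1`, `f' β = 0`, in integrated form, and is
continued to a `C¹` function on `ℝ` that is constant beyond `β`; `p` is its derivative. -/
structure RadialSolution (ρ : ℝ → ℝ) (α β τ : ℝ) (f p : ℝ → ℝ) : Prop where
  hasDerivAt : ∀ r, HasDerivAt f (p r) r
  continuous_deriv : Continuous p
  flux_eq : ∀ r ∈ Set.Icc α β, ρ r * p r = τ * ∫ t in r..β, ρ t * f t
  eq_one : ∀ r, β ≤ r → f r = 1

theorem hasDerivAt_integral_left {g : ℝ → ℝ} (hg : Continuous g) (b r : ℝ) :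
    HasDerivAt (fun s => ∫ t in s..b, g t) (-g r) r :=
  intervalIntegral.integral_hasDerivAt_left (hg.intervalIntegrable _ _)
    hg.aestronglyMeasurable.stronglyMeasurableAtFilter hg.continuousAt

theorem continuous_integral_left {g : ℝ → ℝ} (hg : Continuous g) (b : ℝ) :
    Continuous (fun s => ∫ t in s..b, g t) :=
  continuous_iff_continuousAt.2 fun r => (hasDerivAt_integral_left hg b r).continuousAt

/-! ### Energy identity and Picone's inequality -/

namespace RadialSolution

variable {ρ : ℝ → ℝ} {α β τ : ℝ} {f p : ℝ → ℝ}

theorem continuous (h : RadialSolution ρ α β τ f p) : Continuous f :=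
  continuous_iff_continuousAt.2 fun r => (h.hasDerivAt r).continuousAt

theorem deriv_eq_zero_of_lt (h : RadialSolution ρ α β τ f p) {r : ℝ} (hr : β < r) : p r = 0 := by
  have h1 : HasDerivAt f 0 r := by
    refine (hasDerivAt_const r (1 : ℝ)).congr_of_eventuallyEq ?_
    filter_upwards [lt_mem_nhds hr] with s hs using h.eq_one s hs.le
  exact (h.hasDerivAt r).unique h1

/-- The energy identity for a radial solution. -/
theorem energy (h : RadialSolution ρ α β τ f p) (hαβ : α < β) (hρ : Continuous ρ) :
    (∫ r in α..β, ρ r * p r ^ 2) + ρ α * p α * f α = τ * ∫ r in α..β, ρ r * f r ^ 2 := by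
  have hf := h.continuous
  have hp := h.continuous_deriv
  -- `y` is the flux `ρ p`. In integral form it is differentiable, although `p` is only continuous
  -- and `ρ` need not be differentiable.
  set y : ℝ → ℝ := fun r => τ * ∫ t in r..β, ρ t * f t with hy
  have hyd : ∀ r, HasDerivAt y (τ * -(ρ r * f r)) r := fun r =>
    (hasDerivAt_integral_left (hρ.mul hf) β r).const_mul τ
  have hyc : Continuous y := continuous_iff_continuousAt.2 fun r => (hyd r).continuousAt
  have key := intervalIntegral.integral_eq_sub_of_hasDerivAt (a := α) (b := β)
    (f := fun r => y r * f r) (fun r _ => (hyd r).mul (h.hasDerivAt r))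
    (Continuous.intervalIntegrable (by fun_prop) _ _)
  have hyβ : y β = 0 := by simp [hy]
  have hyα : y α = ρ α * p α := (h.flux_eq α ⟨le_rfl, hαβ.le⟩).symm
  have e1 : ∫ r in α..β, (τ * -(ρ r * f r) * f r + y r * p r) =
      ∫ r in α..β, (ρ r * p r ^ 2 - τ * (ρ r * f r ^ 2)) := by
    refine intervalIntegral.integral_congr fun r hr => ?_
    rw [Set.uIcc_of_le hαβ.le] at hr
    have : y r = ρ r * p r := (h.flux_eq r hr).symm
    simp only [this]; ring
  rw [e1, intervalIntegral.integral_sub (Continuous.intervalIntegrable (by fun_prop) _ _)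
    (Continuous.intervalIntegrable (by fun_prop) _ _), intervalIntegral.integral_const_mul,
    hyβ, hyα] at key
  linarith

/-- Picone's inequality: a positive radial solution gives a lower bound for the energy of every
`C¹` function. -/
theorem picone (h : RadialSolution ρ α β τ f p) (hαβ : α < β) (hρ : Continuous ρ)
    (hρ0 : ∀ r, 0 < ρ r) (hpos : ∀ r ∈ Set.Icc α β, 0 < f r) {ψ ψ' : ℝ → ℝ}
    (hψ : ∀ r, HasDerivAt ψ (ψ' r) r) (hψ' : Continuous ψ') :
    τ * ∫ r in α..β, ρ r * ψ r ^ 2 ≤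
      (∫ r in α..β, ρ r * ψ' r ^ 2) + p α / f α * (ρ α * ψ α ^ 2) := by
  have hf := h.continuous
  have hp := h.continuous_deriv
  have hψc : Continuous ψ := continuous_iff_continuousAt.2 fun r => (hψ r).continuousAt
  set y : ℝ → ℝ := fun r => τ * ∫ t in r..β, ρ t * f t with hy
  have hyd : ∀ r, HasDerivAt y (τ * -(ρ r * f r)) r := fun r =>
    (hasDerivAt_integral_left (hρ.mul hf) β r).const_mul τ
  have hyc : Continuous y := continuous_iff_continuousAt.2 fun r => (hyd r).continuousAt
  have hne : ∀ r ∈ Set.Icc α β, f r ≠ 0 := fun r hr => (hpos r hr).ne'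
  -- `Q'` is the derivative of `ρ p ψ² / f`. It falls short of `ρ ψ'² - τ ρ ψ²` exactly by the
  -- square `ρ (ψ' - (p / f) ψ)²`.
  set Q' : ℝ → ℝ := fun r =>
    ((τ * -(ρ r * f r) * ψ r ^ 2 + y r * (2 * ψ r * ψ' r)) * f r - y r * ψ r ^ 2 * p r) / f r ^ 2
    with hQ'
  have hQ'c : ContinuousOn Q' (Set.uIcc α β) := by
    rw [Set.uIcc_of_le hαβ.le]
    refine ContinuousOn.div (Continuous.continuousOn (by fun_prop))
      (Continuous.continuousOn (by fun_prop)) fun r hr => pow_ne_zero 2 (hne r hr)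
  have key := intervalIntegral.integral_eq_sub_of_hasDerivAt (a := α) (b := β)
    (f := fun r => y r * ψ r ^ 2 / f r) (f' := Q') (fun r hr => by
      rw [Set.uIcc_of_le hαβ.le] at hr
      have := (((hyd r).mul ((hψ r).pow 2)).div (h.hasDerivAt r) (hne r hr))
      exact this.congr_deriv (by simp [hQ']))
    hQ'c.intervalIntegrable
  have hyβ : y β = 0 := by simp [hy]
  have hyα : y α = ρ α * p α := (h.flux_eq α ⟨le_rfl, hαβ.le⟩).symm
  have hle : ∫ r in α..β, Q' r ≤ ∫ r in α..β, (ρ r * ψ' r ^ 2 - τ * (ρ r * ψ r ^ 2)) := by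
    refine intervalIntegral.integral_mono_on hαβ.le hQ'c.intervalIntegrable
      (Continuous.intervalIntegrable (by fun_prop) _ _) fun r hr => ?_
    have hyr : y r = ρ r * p r := (h.flux_eq r hr).symm
    have hfr := hne r hr
    have : ρ r * ψ' r ^ 2 - τ * (ρ r * ψ r ^ 2) - Q' r = ρ r * (ψ' r - p r / f r * ψ r) ^ 2 := by
      simp only [hQ', hyr]
      field_simp
      ring
    nlinarith [mul_nonneg (hρ0 r).le (sq_nonneg (ψ' r - p r / f r * ψ r))]
  rw [intervalIntegral.integral_sub (Continuous.intervalIntegrable (by fun_prop) _ _)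
    (Continuous.intervalIntegrable (by fun_prop) _ _), intervalIntegral.integral_const_mul,
    key, hyβ, hyα] at hle
  have e : ρ α * p α * ψ α ^ 2 / f α = p α / f α * (ρ α * ψ α ^ 2) := by ring
  rw [e] at hle
  simp at hle
  linarith

end RadialSolution

/-- The coefficients of the expansion of the radial solution in powers of `-τ`. The argument is
clamped to `[α, β]`. -/
def radialCoeff (ρ : ℝ → ℝ) (α β : ℝ) : ℕ → ℝ → ℝ
  | 0, _ => 1
  | k + 1, r => ∫ s in (max α (min r β))..β, (ρ s)⁻¹ * ∫ t in s..β, ρ t * radialCoeff ρ α β k t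

/-! ### The radial solution as a power series in `-τ` -/

section expansion

variable {ρ : ℝ → ℝ} {α β : ℝ}

theorem continuous_radialCoeff (hρ : Continuous ρ) (hρ0 : ∀ r, 0 < ρ r) (k : ℕ) :
    Continuous (radialCoeff ρ α β k) := by
  induction k with
  | zero => exact continuous_const
  | succ k ih =>
    have h1 : Continuous fun s => (ρ s)⁻¹ * ∫ t in s..β, ρ t * radialCoeff ρ α β k t :=
      (hρ.inv₀ fun r => (hρ0 r).ne').mul (continuous_integral_left (hρ.mul ih) β)
    exact (continuous_integral_left h1 β).comp (by fun_prop)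

/-- Each recursion step integrates twice. The inner integral is bounded crudely by the length `β -
α`; the outer one alone supplies the factor `1 / (k + 1)`, which is enough for convergence for all
`τ`. -/
theorem radialCoeff_bounds (hαβ : α < β) (hρ : Continuous ρ) (hρ0 : ∀ r, 0 < ρ r) :
    ∃ M : ℝ, 0 ≤ M ∧ ∀ k, ∀ r ∈ Set.Icc α β, 0 ≤ radialCoeff ρ α β k r ∧
      radialCoeff ρ α β k r ≤ M ^ k * (β - r) ^ k / k.factorial := by
  obtain ⟨C, hC⟩ := (isCompact_Icc (a := α) (b := β)).exists_bound_of_continuousOn hρ.continuousOn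
  obtain ⟨c, hc⟩ := (isCompact_Icc (a := α) (b := β)).exists_bound_of_continuousOn
    (hρ.inv₀ fun r => (hρ0 r).ne').continuousOn
  have hC0 : 0 ≤ C := (norm_nonneg _).trans (hC α ⟨le_rfl, hαβ.le⟩)
  have hc0 : 0 ≤ c := (norm_nonneg _).trans (hc α ⟨le_rfl, hαβ.le⟩)
  have hL : 0 ≤ β - α := by linarith
  refine ⟨c * (C * (β - α)), by positivity, fun k => ?_⟩
  set M := c * (C * (β - α)) with hM
  have hM0 : 0 ≤ M := by positivity
  induction k with
  | zero => intro r _; simp [radialCoeff]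
  | succ k ih =>
    have hcont := continuous_radialCoeff (α := α) (β := β) hρ hρ0 k
    have h1 : Continuous fun s => (ρ s)⁻¹ * ∫ t in s..β, ρ t * radialCoeff ρ α β k t :=
      (hρ.inv₀ fun r => (hρ0 r).ne').mul (continuous_integral_left (hρ.mul hcont) β)
    have inner0 : ∀ s ∈ Set.Icc α β, 0 ≤ ∫ t in s..β, ρ t * radialCoeff ρ α β k t := fun s hs =>
      intervalIntegral.integral_nonneg hs.2 fun t ht =>
        mul_nonneg (hρ0 t).le (ih t ⟨hs.1.trans ht.1, ht.2⟩).1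
    have inner1 : ∀ s ∈ Set.Icc α β, ∫ t in s..β, ρ t * radialCoeff ρ α β k t ≤
        (β - α) * (C * (M ^ k * (β - s) ^ k / k.factorial)) := by
      intro s hs
      have hsβ : 0 ≤ β - s := by linarith [hs.2]
      calc _ ≤ ∫ t in s..β, C * (M ^ k * (β - s) ^ k / k.factorial) := by
            refine intervalIntegral.integral_mono_on hs.2
              ((hρ.mul hcont).intervalIntegrable _ _) (by simp) fun t ht => ?_
            have ht' : t ∈ Set.Icc α β := ⟨hs.1.trans ht.1, ht.2⟩
            refine mul_le_mul ((le_abs_self _).trans (hC t ht')) ((ih t ht').2.trans ?_)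
              (ih t ht').1 hC0
            have : 0 ≤ β - t := by linarith [ht.2]
            have : β - t ≤ β - s := by linarith [ht.1]
            gcongr
        _ = (β - s) * (C * (M ^ k * (β - s) ^ k / k.factorial)) := by
            rw [intervalIntegral.integral_const, smul_eq_mul]
        _ ≤ _ := by
            have : β - s ≤ β - α := by linarith [hs.1]
            gcongr
    intro r hr
    have hcl : max α (min r β) = r := by rw [min_eq_left hr.2, max_eq_right hr.1]
    simp only [radialCoeff, hcl]
    constructor
    · refine intervalIntegral.integral_nonneg hr.2 fun s hs =>
        mul_nonneg (inv_pos.2 (hρ0 s)).le (inner0 s ⟨hr.1.trans hs.1, hs.2⟩)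
    · calc _ ≤ ∫ s in r..β, M ^ (k + 1) / k.factorial * (β - s) ^ k := by
            refine intervalIntegral.integral_mono_on hr.2 (h1.intervalIntegrable _ _)
              (Continuous.intervalIntegrable (by fun_prop) _ _) fun s hs => ?_
            have hs' : s ∈ Set.Icc α β := ⟨hr.1.trans hs.1, hs.2⟩
            calc _ ≤ c * ((β - α) * (C * (M ^ k * (β - s) ^ k / k.factorial))) :=
                  mul_le_mul ((le_abs_self _).trans (hc s hs')) (inner1 s hs') (inner0 s hs') hc0
              _ = _ := by rw [hM]; ring
        _ = M ^ (k + 1) / k.factorial * ((β - r) ^ (k + 1) / (k + 1)) := by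
            rw [intervalIntegral.integral_const_mul,
              intervalIntegral.integral_comp_sub_left (fun x => x ^ k) β]
            simp
        _ = _ := by
            rw [Nat.factorial_succ]; push_cast
            have : (k.factorial : ℝ) ≠ 0 := by positivity
            field_simp

theorem radialCoeff_clamp (k : ℕ) (hαβ : α < β) (r : ℝ) :
    radialCoeff ρ α β k r = radialCoeff ρ α β k (max α (min r β)) := by
  cases k with
  | zero => rfl
  | succ k =>
    have : max α (min (max α (min r β)) β) = max α (min r β) := by
      rw [min_eq_left (max_le hαβ.le (min_le_right _ _)), ← max_assoc, max_self]
    simp only [radialCoeff, this]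

/-- Clamping the argument carries the bound from `[α, β]` to the whole line. -/
theorem abs_radialCoeff_le (hαβ : α < β) (hρ : Continuous ρ) (hρ0 : ∀ r, 0 < ρ r) :
    ∃ A : ℝ, 0 ≤ A ∧ ∀ k r, |radialCoeff ρ α β k r| ≤ A ^ k / k.factorial := by
  obtain ⟨M, hM0, hM⟩ := radialCoeff_bounds hαβ hρ hρ0
  have hL : 0 ≤ β - α := by linarith
  refine ⟨M * (β - α), by positivity, fun k r => ?_⟩
  rw [radialCoeff_clamp k hαβ r]
  have hr : max α (min r β) ∈ Set.Icc α β := ⟨le_max_left _ _, max_le hαβ.le (min_le_right _ _)⟩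
  set s := max α (min r β)
  rw [abs_of_nonneg (hM k s hr).1, mul_pow]
  refine (hM k s hr).2.trans ?_
  have : 0 ≤ β - s := by linarith [hr.2]
  have : β - s ≤ β - α := by linarith [hr.1]
  gcongr

/-- The solution of `(ρ f')' = -τ ρ f`, `f β = 1`, `f' β = 0`, as a power series in `-τ`. -/
def radialFn (ρ : ℝ → ℝ) (α β τ r : ℝ) : ℝ := ∑' k, (-τ) ^ k * radialCoeff ρ α β k r

theorem norm_term_le {A : ℝ} (hA : ∀ k r, |radialCoeff ρ α β k r| ≤ A ^ k / k.factorial)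
    (τ r : ℝ) (k : ℕ) :
    ‖(-τ) ^ k * radialCoeff ρ α β k r‖ ≤ (|τ| * A) ^ k / k.factorial := by
  rw [norm_mul, norm_pow, norm_neg, mul_pow, mul_div_assoc]
  exact mul_le_mul_of_nonneg_left (hA k r) (by positivity)

theorem hasSum_radialFn (hαβ : α < β) (hρ : Continuous ρ) (hρ0 : ∀ r, 0 < ρ r) (τ r : ℝ) :
    HasSum (fun k => (-τ) ^ k * radialCoeff ρ α β k r) (radialFn ρ α β τ r) := by
  obtain ⟨A, -, hA⟩ := abs_radialCoeff_le hαβ hρ hρ0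
  exact (Summable.of_norm_bounded (Real.summable_pow_div_factorial _)
    (norm_term_le hA τ r)).hasSum

/-- The majorant depends on `τ`, so the M-test is applied on strips of bounded `τ`. Joint continuity
serves the compactness argument for the first zero and the continuity of the shooting function. -/
theorem continuous_radialFn (hαβ : α < β) (hρ : Continuous ρ) (hρ0 : ∀ r, 0 < ρ r) :
    Continuous fun q : ℝ × ℝ => radialFn ρ α β q.1 q.2 := by
  obtain ⟨A, hA0, hA⟩ := abs_radialCoeff_le hαβ hρ hρ0
  have hcont := continuous_radialCoeff (α := α) (β := β) hρ hρ0
  rw [continuous_iff_continuousAt]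
  rintro ⟨τ, r⟩
  have hon : ContinuousOn
      (fun q : ℝ × ℝ => ∑' k, (-q.1) ^ k * radialCoeff ρ α β k q.2) {q | |q.1| < |τ| + 1} := by
    refine continuousOn_tsum (fun k => Continuous.continuousOn ?_)
      (Real.summable_pow_div_factorial ((|τ| + 1) * A)) ?_
    · exact (continuous_fst.neg.pow k).mul ((hcont k).comp continuous_snd)
    · rintro k ⟨σ, s⟩ hσ
      have hσ' : |σ| ≤ |τ| + 1 := le_of_lt hσ
      have h2 := pow_le_pow_left₀ (mul_nonneg (abs_nonneg σ) hA0)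
        (mul_le_mul_of_nonneg_right hσ' hA0) k
      exact (norm_term_le hA σ s k).trans (by gcongr)
  refine hon.continuousAt (IsOpen.mem_nhds (isOpen_lt (by fun_prop) continuous_const) ?_)
  simp

theorem continuous_radialFn_right (hαβ : α < β) (hρ : Continuous ρ) (hρ0 : ∀ r, 0 < ρ r)
    (τ : ℝ) : Continuous (radialFn ρ α β τ) :=
  (continuous_radialFn hαβ hρ hρ0).comp (Continuous.prodMk_right τ)

theorem one_le_radialFn (hαβ : α < β) (hρ : Continuous ρ) (hρ0 : ∀ r, 0 < ρ r) {τ r : ℝ}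
    (hτ : τ ≤ 0) (hr : r ∈ Set.Icc α β) : 1 ≤ radialFn ρ α β τ r := by
  obtain ⟨M, -, hM⟩ := radialCoeff_bounds hαβ hρ hρ0
  have h := (hasSum_radialFn hαβ hρ hρ0 τ r)
  have := h.summable.le_tsum 0 fun k _ =>
    mul_nonneg (pow_nonneg (by linarith) k) (hM k r hr).1
  rw [h.tsum_eq] at this
  simpa [radialCoeff] using this

/-- Integration of an exponentially dominated series of continuous functions against a
continuous weight. -/
theorem hasSum_integral_weighted {w B : ℝ → ℝ} (hw : Continuous w) (hB : Continuous B)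
    {g : ℕ → ℝ → ℝ} (hg : ∀ k, Continuous (g k)) {G : ℝ → ℝ} {a : ℝ}
    (hb : ∀ k r, |g k r| ≤ B r * (a ^ k / k.factorial))
    (hG : ∀ r, HasSum (fun k => g k r) (G r)) (s b : ℝ) :
    HasSum (fun k => ∫ t in s..b, w t * g k t) (∫ t in s..b, w t * G t) := by
  refine intervalIntegral.hasSum_integral_of_dominated_convergence
    (fun k t => |w t| * B t * (a ^ k / k.factorial)) (fun k => ?_) (fun k => ?_) ?_ ?_ ?_
  · exact (hw.mul (hg k)).aestronglyMeasurable
  · refine ae_of_all _ fun t _ => ?_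
    rw [norm_mul, mul_assoc]
    exact mul_le_mul_of_nonneg_left (hb k t) (abs_nonneg _)
  · exact ae_of_all _ fun t _ => (Real.summable_pow_div_factorial _).mul_left _
  · simp_rw [tsum_mul_left]
    exact Continuous.intervalIntegrable (by fun_prop) _ _
  · exact ae_of_all _ fun t _ => (hG t).mul_left _

/-- Integrating the series termwise twice shifts the index by one, so the double integral reproduces
the series without its leading term `1`. -/
theorem radialFn_eq (hαβ : α < β) (hρ : Continuous ρ) (hρ0 : ∀ r, 0 < ρ r) (τ : ℝ) {r : ℝ}
    (hr : r ∈ Set.Icc α β) : radialFn ρ α β τ r =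
      1 - τ * ∫ s in r..β, (ρ s)⁻¹ * ∫ t in s..β, ρ t * radialFn ρ α β τ t := by
  obtain ⟨A, hA0, hA⟩ := abs_radialCoeff_le hαβ hρ hρ0
  have hcont := continuous_radialCoeff (α := α) (β := β) hρ hρ0
  have hcl : max α (min r β) = r := by rw [min_eq_left hr.2, max_eq_right hr.1]
  set g : ℕ → ℝ → ℝ := fun k t => (-τ) ^ k * radialCoeff ρ α β k t with hg
  have hgc : ∀ k, Continuous (g k) := fun k => continuous_const.mul (hcont k)
  have hgb : ∀ k t, |g k t| ≤ (|τ| * A) ^ k / k.factorial := fun k t => norm_term_le hA τ t k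
  have hinner := hasSum_integral_weighted hρ (B := fun _ => 1) continuous_const hgc
    (fun k t => by simpa using hgb k t) (hasSum_radialFn hαβ hρ hρ0 τ)
  have hinnerb : ∀ k s, |∫ t in s..β, ρ t * g k t| ≤
      |∫ t in s..β, ρ t| * ((|τ| * A) ^ k / k.factorial) := by
    intro k s
    have hnn : 0 ≤ (|τ| * A) ^ k / k.factorial := by positivity
    have hi : IntervalIntegrable (fun t => ρ t * ((|τ| * A) ^ k / k.factorial)) volume s β :=
      (hρ.mul continuous_const).intervalIntegrable _ _
    have h1 : ‖∫ t in s..β, ρ t * g k t‖ ≤ |∫ t in s..β, ρ t * ((|τ| * A) ^ k / k.factorial)| := by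
      refine intervalIntegral.norm_integral_le_abs_of_norm_le (ae_of_all _ fun t => ?_) hi
      rw [norm_mul, Real.norm_of_nonneg (hρ0 t).le]
      exact mul_le_mul_of_nonneg_left (hgb k t) (hρ0 t).le
    rwa [intervalIntegral.integral_mul_const, abs_mul, abs_of_nonneg hnn] at h1
  have houter := hasSum_integral_weighted (hρ.inv₀ fun r => (hρ0 r).ne')
    (continuous_integral_left hρ β).abs (fun k => continuous_integral_left (hρ.mul (hgc k)) β)
    hinnerb (fun s => hinner s β) r β
  have hstep : ∀ k, g (k + 1) r =
      -τ * ∫ s in r..β, (ρ s)⁻¹ * ∫ t in s..β, ρ t * g k t := by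
    intro k
    have e : ∀ s, ∫ t in s..β, ρ t * g k t =
        (-τ) ^ k * ∫ t in s..β, ρ t * radialCoeff ρ α β k t := by
      intro s
      rw [← intervalIntegral.integral_const_mul]
      refine intervalIntegral.integral_congr fun t _ => ?_
      simp only [hg]; ring
    simp_rw [e, mul_left_comm _ ((-τ) ^ k), intervalIntegral.integral_const_mul]
    simp only [hg, radialCoeff, hcl]
    ring
  have h1 := (hasSum_radialFn hαβ hρ hρ0 τ r)
  have h2 : HasSum (fun k => g (k + 1) r) (radialFn ρ α β τ r - 1) := by
    rw [← hasSum_nat_add_iff' 1] at h1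
    simpa [radialCoeff, hg] using h1
  simp_rw [hstep] at h2
  have h3 := h2.unique (houter.mul_left _)
  simp only [Pi.inv_apply] at h3
  linarith

/-- The derivative of `radialFn` on `[α, β]`, continued by constants. -/
def radialDeriv (ρ : ℝ → ℝ) (α β τ r : ℝ) : ℝ :=
  τ * ((ρ (max α (min r β)))⁻¹ * ∫ t in (max α (min r β))..β, ρ t * radialFn ρ α β τ t)

/-- The `C¹` continuation of `radialFn` that is constant beyond `β`. -/
def radialExt (ρ : ℝ → ℝ) (α β τ r : ℝ) : ℝ := 1 - ∫ s in r..β, radialDeriv ρ α β τ s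

theorem radialExt_eq (hαβ : α < β) (hρ : Continuous ρ) (hρ0 : ∀ r, 0 < ρ r) (τ : ℝ) {r : ℝ}
    (hr : r ∈ Set.Icc α β) : radialExt ρ α β τ r = radialFn ρ α β τ r := by
  rw [radialFn_eq hαβ hρ hρ0 τ hr, radialExt, ← intervalIntegral.integral_const_mul]
  congr 1
  refine intervalIntegral.integral_congr fun s hs => ?_
  rw [Set.uIcc_of_le hr.2] at hs
  have hcl : max α (min s β) = s := by rw [min_eq_left hs.2, max_eq_right (hr.1.trans hs.1)]
  simp only [radialDeriv, hcl]

/-- The clamped series can have a corner at `α`; continuing the derivative by constants and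
integrating back avoids it. Beyond `β` the clamped derivative is an integral from `β` to `β`, hence
zero. -/
theorem radialSolution_radialExt (hαβ : α < β) (hρ : Continuous ρ) (hρ0 : ∀ r, 0 < ρ r) (τ : ℝ) :
    RadialSolution ρ α β τ (radialExt ρ α β τ) (radialDeriv ρ α β τ) := by
  have hc := continuous_radialFn_right hαβ hρ hρ0 τ
  have h1 : Continuous fun r => τ * ((ρ r)⁻¹ * ∫ t in r..β, ρ t * radialFn ρ α β τ t) :=
    continuous_const.mul
      ((hρ.inv₀ fun r => (hρ0 r).ne').mul (continuous_integral_left (hρ.mul hc) β))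
  have hp : Continuous (radialDeriv ρ α β τ) :=
    h1.comp (by fun_prop : Continuous fun r => max α (min r β))
  refine ⟨fun r => ?_, hp, fun r hr => ?_, fun r hr => ?_⟩
  · exact ((hasDerivAt_integral_left hp β r).const_sub 1).congr_deriv (neg_neg _)
  · have hcl : max α (min r β) = r := by rw [min_eq_left hr.2, max_eq_right hr.1]
    have e : ∫ t in r..β, ρ t * radialExt ρ α β τ t = ∫ t in r..β, ρ t * radialFn ρ α β τ t := by
      refine intervalIntegral.integral_congr fun s hs => ?_
      rw [Set.uIcc_of_le hr.2] at hs
      simp only [radialExt_eq hαβ hρ hρ0 τ ⟨hr.1.trans hs.1, hs.2⟩]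
    rw [e, radialDeriv, hcl]
    have := (hρ0 r).ne'
    field_simp
  · have e : ∫ s in r..β, radialDeriv ρ α β τ s = ∫ s in r..β, (0 : ℝ) := by
      refine intervalIntegral.integral_congr fun s hs => ?_
      rw [Set.uIcc_of_ge hr] at hs
      have hcl : max α (min s β) = β := by rw [min_eq_right hs.1, max_eq_right hαβ.le]
      simp [radialDeriv, hcl]
    simp [radialExt, e]

theorem continuous_radialDeriv_left (hαβ : α < β) (hρ : Continuous ρ) (hρ0 : ∀ r, 0 < ρ r) :
    Continuous fun τ => radialDeriv ρ α β τ α := by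
  have hf := continuous_radialFn hαβ hρ hρ0
  have hcl : max α (min α β) = α := by rw [min_eq_left hαβ.le, max_self]
  simp only [radialDeriv, hcl]
  refine continuous_id.mul (continuous_const.mul ?_)
  refine intervalIntegral.continuous_parametric_intervalIntegral_of_continuous'
    (f := fun τ t => ρ t * radialFn ρ α β τ t) ?_ α β
  exact (hρ.comp continuous_snd).mul hf

theorem continuous_radialExt_left (hαβ : α < β) (hρ : Continuous ρ) (hρ0 : ∀ r, 0 < ρ r) {r : ℝ}
    (hr : r ∈ Set.Icc α β) : Continuous fun τ => radialExt ρ α β τ r := by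
  simp_rw [radialExt_eq hαβ hρ hρ0 _ hr]
  exact (continuous_radialFn hαβ hρ hρ0).comp (Continuous.prodMk_left r)

theorem radialExt_zero (r : ℝ) : radialExt ρ α β 0 r = 1 := by
  simp [radialExt, radialDeriv]

end expansion

/-! ### Monotonicity of radial solutions -/

namespace RadialSolution

variable {ρ : ℝ → ℝ} {α β τ : ℝ} {f p : ℝ → ℝ}

theorem integral_deriv (h : RadialSolution ρ α β τ f p) (a b : ℝ) :
    ∫ r in a..b, p r = f b - f a :=
  intervalIntegral.integral_eq_sub_of_hasDerivAt (fun r _ => h.hasDerivAt r)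
    (h.continuous_deriv.intervalIntegrable _ _)

/-- By the flux identity `τ ρ p = τ² ∫ ρ f`, and the integral is positive because `f β = 1`. The
factor `τ` treats both signs at once. -/
theorem mul_deriv_pos (h : RadialSolution ρ α β τ f p) (hρ : Continuous ρ)
    (hρ0 : ∀ r, 0 < ρ r) (hτ : τ ≠ 0) (hf : ∀ r ∈ Set.Icc α β, 0 ≤ f r) {r : ℝ}
    (hr : r ∈ Set.Ico α β) : 0 < τ * p r := by
  have hI : 0 < ∫ t in r..β, ρ t * f t := by
    refine intervalIntegral.integral_pos hr.2 (hρ.mul h.continuous).continuousOn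
      (fun t ht => mul_nonneg (hρ0 t).le (hf t ⟨hr.1.trans ht.1.le, ht.2⟩))
      ⟨β, ⟨hr.2.le, le_rfl⟩, ?_⟩
    rw [h.eq_one β le_rfl, mul_one]
    exact hρ0 β
  have h1 := h.flux_eq r ⟨hr.1, hr.2.le⟩
  have h2 : ρ r * (τ * p r) = τ ^ 2 * ∫ t in r..β, ρ t * f t := by
    rw [mul_left_comm, h1]; ring
  have h3 : 0 < ρ r * (τ * p r) := by rw [h2]; positivity
  exact pos_of_mul_pos_right h3 (hρ0 r).le

/-- `τ f` increases strictly up to `β`, where `f = 1`. This sign makes the comparison of shells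
strict. -/
theorem mul_sq_sub_one_neg (h : RadialSolution ρ α β τ f p) (hρ : Continuous ρ)
    (hρ0 : ∀ r, 0 < ρ r) (hτ : τ ≠ 0) (hf : ∀ r ∈ Set.Icc α β, 0 ≤ f r) {r : ℝ}
    (hr : r ∈ Set.Ico α β) : τ * (f r ^ 2 - 1) < 0 := by
  have h1 : 0 < ∫ t in r..β, τ * p t :=
    intervalIntegral.intervalIntegral_pos_of_pos_on
      ((h.continuous_deriv.const_mul τ).intervalIntegrable _ _)
      (fun t ht => h.mul_deriv_pos hρ hρ0 hτ hf ⟨hr.1.trans ht.1.le, ht.2⟩) hr.2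
  rw [intervalIntegral.integral_const_mul, h.integral_deriv, h.eq_one β le_rfl] at h1
  have h2 := hf r ⟨hr.1, hr.2.le⟩
  nlinarith

theorem pos_of_ne_zero (h : RadialSolution ρ α β τ f p)
    (hf : ∀ r ∈ Set.Icc α β, f r ≠ 0) : ∀ r ∈ Set.Icc α β, 0 < f r := by
  intro r hr
  by_contra! hle
  obtain ⟨s, hs, hs0⟩ := intermediate_value_Icc hr.2 h.continuous.continuousOn
    (show (0 : ℝ) ∈ Set.Icc (f r) (f β) from ⟨hle, by simp [h.eq_one β le_rfl]⟩)
  exact hf s ⟨hr.1.trans hs.1, hs.2⟩ hs0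

/-- For strongly negative `τ` the logarithmic derivative at `α` is strongly negative. -/
theorem deriv_le_neg_mul (h : RadialSolution ρ α β τ f p) (hαβ : α < β) (hρ : Continuous ρ)
    (hρ0 : ∀ r, 0 < ρ r) (hmono : Monotone ρ) (hf : ∀ r ∈ Set.Icc α β, 0 ≤ f r) {k δ : ℝ}
    (hδ : 0 < δ) (hk : 0 < k) (hδβ : δ ≤ β - α) (hkδ : k * δ ≤ 1 / 2) (hτ : τ = -(2 * k / δ)) :
    p α ≤ -k * f α := by
  have hτ0 : τ < 0 := by rw [hτ]; exact neg_neg_of_pos (by positivity)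
  have hint : ∀ a b, IntervalIntegrable (fun t => ρ t * f t) volume a b := fun a b =>
    (hρ.mul h.continuous).intervalIntegrable _ _
  have hαm : α ∈ Set.Icc α β := ⟨le_rfl, hαβ.le⟩
  -- Suppose `p α > -k f α`. The flux increases and `ρ` is monotone, so `p ≥ p α`; with `k δ ≤ 1/2`,
  -- `f` keeps at least half of `f α` on `[α, α + δ]`. The flux identity then gives `ρ α p α ≤ τ δ ρ
  -- α f α / 2`, which is `-k ρ α f α` for the chosen `τ`.
  by_contra! hlt
  have hpα : p α ≤ 0 := by
    have := h.mul_deriv_pos hρ hρ0 hτ0.ne hf ⟨le_rfl, hαβ⟩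
    nlinarith
  have hfα : 0 ≤ f α := hf α hαm
  have hp : ∀ r ∈ Set.Icc α β, p α ≤ p r := by
    intro r hr
    have h1 := h.flux_eq r hr
    have h2 := h.flux_eq α hαm
    have h3 : 0 ≤ ∫ t in α..r, ρ t * f t := intervalIntegral.integral_nonneg hr.1
      fun t ht => mul_nonneg (hρ0 t).le (hf t ⟨ht.1, ht.2.trans hr.2⟩)
    have h4 := intervalIntegral.integral_add_adjacent_intervals (hint α r) (hint r β)
    have h5 : ρ α * p α ≤ ρ r * p r := by rw [h1, h2, ← h4]; nlinarith
    have h6 := mul_le_mul_of_nonpos_right (hmono hr.1) hpα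
    exact le_of_mul_le_mul_left (h6.trans h5) (hρ0 r)
  have hfr : ∀ r ∈ Set.Icc α (α + δ), f α / 2 ≤ f r := by
    intro r hr
    have h1 := h.integral_deriv α r
    have h2 : ∫ t in α..r, p α ≤ ∫ t in α..r, p t :=
      intervalIntegral.integral_mono_on hr.1 (by simp)
        (h.continuous_deriv.intervalIntegrable _ _)
        fun t ht => hp t ⟨ht.1, by linarith [ht.2, hr.2]⟩
    rw [intervalIntegral.integral_const, smul_eq_mul, h1] at h2
    have h3 : 0 ≤ r - α := by linarith [hr.1]
    have h4 : r - α ≤ δ := by linarith [hr.2]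
    have h5 : k * (r - α) ≤ 1 / 2 := (mul_le_mul_of_nonneg_left h4 hk.le).trans hkδ
    nlinarith [mul_le_mul_of_nonneg_left hlt.le h3, mul_le_mul_of_nonneg_right h5 hfα]
  have h1 : δ * (ρ α * (f α / 2)) ≤ ∫ t in α..β, ρ t * f t := by
    have h2 := intervalIntegral.integral_add_adjacent_intervals (hint α (α + δ)) (hint (α + δ) β)
    have h3 : 0 ≤ ∫ t in (α + δ)..β, ρ t * f t :=
      intervalIntegral.integral_nonneg (by linarith) fun t ht =>
        mul_nonneg (hρ0 t).le (hf t ⟨by linarith [ht.1], ht.2⟩)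
    have h4 : ∫ t in α..(α + δ), ρ α * (f α / 2) ≤ ∫ t in α..(α + δ), ρ t * f t :=
      intervalIntegral.integral_mono_on (by linarith) (by simp) (hint _ _) fun t ht =>
        mul_le_mul (hmono ht.1) (hfr t ht) (by linarith) (hρ0 t).le
    rw [intervalIntegral.integral_const, smul_eq_mul] at h4
    have h5 : α + δ - α = δ := by ring
    rw [h5] at h4
    linarith
  have h2 := h.flux_eq α hαm
  have h3 : ρ α * p α ≤ ρ α * (-k * f α) := by
    rw [h2]
    calc _ ≤ τ * (δ * (ρ α * (f α / 2))) := mul_le_mul_of_nonpos_left h1 hτ0.le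
      _ = _ := by rw [hτ]; field_simp
  exact absurd (le_of_mul_le_mul_left h3 (hρ0 α)) (not_le.2 hlt)

end RadialSolution

/-! ### Shooting for the radial eigenvalue -/

section shooting

variable {ρ : ℝ → ℝ} {α β : ℝ}

/-- The first Dirichlet eigenvalue of the radial problem. -/
theorem exists_first_zero (hαβ : α < β) (hρ : Continuous ρ) (hρ0 : ∀ r, 0 < ρ r) :
    ∃ T > 0, radialExt ρ α β T α = 0 ∧ (∀ r ∈ Set.Icc α β, 0 ≤ radialExt ρ α β T r) ∧
      ∀ τ ∈ Set.Ico 0 T, ∀ r ∈ Set.Icc α β, 0 < radialExt ρ α β τ r := by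
  have hsol := radialSolution_radialExt hαβ hρ hρ0
  obtain ⟨τ₁, hτ₁, r₁, hr₁, hz₁⟩ : ∃ τ > 0, ∃ r ∈ Set.Icc α β, radialExt ρ α β τ r = 0 := by
    -- Without a zero, Picone's inequality for the test function `r - α`, which vanishes at `α`,
    -- gives `τ b ≤ a` for all `τ > 0`; this fails at `a / b + 1`.
    by_contra! hno
    set a := ∫ r in α..β, ρ r * (1 : ℝ) ^ 2 with ha
    set b := ∫ r in α..β, ρ r * (r - α) ^ 2 with hb
    have hb0 : 0 < b := by
      refine intervalIntegral.intervalIntegral_pos_of_pos_on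
        (Continuous.intervalIntegrable (by fun_prop) _ _) (fun r hr => ?_) hαβ
      have : 0 < r - α := by linarith [hr.1]
      have := hρ0 r
      positivity
    have ha0 : 0 ≤ a := intervalIntegral.integral_nonneg hαβ.le fun r _ => by
      have := (hρ0 r).le; positivity
    have hτ : 0 < a / b + 1 := by positivity
    have := (hsol (a / b + 1)).picone hαβ hρ hρ0 ((hsol _).pos_of_ne_zero (hno _ hτ))
      (ψ := fun r => r - α) (ψ' := fun _ => 1) (fun r => (hasDerivAt_id r).sub_const α)
      continuous_const
    simp only [sub_self, ne_eq, OfNat.ofNat_ne_zero, not_false_eq_true, zero_pow, mul_zero,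
      add_zero] at this
    rw [← ha, ← hb, add_mul, div_mul_cancel₀ _ hb0.ne'] at this
    linarith
  -- The zero set is compact, so a least `τ` with a zero exists.
  set S : Set (ℝ × ℝ) := (Set.Icc 0 τ₁ ×ˢ Set.Icc α β) ∩ {q | radialFn ρ α β q.1 q.2 = 0} with hS
  have hScomp : IsCompact S := (isCompact_Icc.prod isCompact_Icc).inter_right
    (isClosed_eq (continuous_radialFn hαβ hρ hρ0) continuous_const)
  have hSne : S.Nonempty := ⟨(τ₁, r₁), ⟨⟨⟨hτ₁.le, le_rfl⟩, hr₁⟩, by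
    simpa [radialExt_eq hαβ hρ hρ0 τ₁ hr₁] using hz₁⟩⟩
  obtain ⟨T, ⟨⟨T', r₀⟩, ⟨⟨hT', hr₀⟩, hz⟩, rfl⟩, hleast⟩ :=
    (hScomp.image continuous_fst).exists_isLeast (hSne.image _)
  simp only at hT' hr₀ hleast hz ⊢
  have hz' : radialExt ρ α β T' r₀ = 0 := by rw [radialExt_eq hαβ hρ hρ0 _ hr₀]; exact hz
  have hT0 : 0 < T' := by
    rcases hT'.1.eq_or_lt with h | h
    · rw [← h, radialExt_zero] at hz'; norm_num at hz'
    · exact h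
  have hpos : ∀ τ ∈ Set.Ico 0 T', ∀ r ∈ Set.Icc α β, 0 < radialExt ρ α β τ r := by
    intro τ hτ
    refine (hsol τ).pos_of_ne_zero fun r hr h0 => ?_
    have : T' ≤ τ := hleast ⟨(τ, r), ⟨⟨⟨hτ.1, hτ.2.le.trans hT'.2⟩, hr⟩, by
      simpa [radialExt_eq hαβ hρ hρ0 τ hr] using h0⟩, rfl⟩
    linarith [hτ.2]
  have hnn : ∀ r ∈ Set.Icc α β, 0 ≤ radialExt ρ α β T' r := by
    intro r hr
    have ht : Tendsto (fun τ => radialExt ρ α β τ r) (𝓝[<] T') (𝓝 (radialExt ρ α β T' r)) :=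
      (continuous_radialExt_left hαβ hρ hρ0 hr).continuousAt.tendsto.mono_left
        nhdsWithin_le_nhds
    refine ge_of_tendsto ht ?_
    filter_upwards [Ico_mem_nhdsLT hT0] with τ hτ using (hpos τ hτ r hr).le
  refine ⟨T', hT0, ?_, hnn, hpos⟩
  -- The solution is strictly increasing and nonnegative, so its zero can only be at `α`.
  rcases hr₀.1.eq_or_lt with h | h
  · rwa [← h] at hz'
  · exfalso
    have h1 : 0 < ∫ t in α..r₀, T' * radialDeriv ρ α β T' t :=
      intervalIntegral.intervalIntegral_pos_of_pos_on
        (((hsol T').continuous_deriv.const_mul T').intervalIntegrable _ _)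
        (fun t ht => (hsol T').mul_deriv_pos hρ hρ0 hT0.ne' hnn
          ⟨ht.1.le, ht.2.trans_le hr₀.2⟩) h
    rw [intervalIntegral.integral_const_mul, (hsol T').integral_deriv, hz'] at h1
    nlinarith [hnn α ⟨le_rfl, hαβ.le⟩]

/-- The first eigenfunction of the radial problem with a Robin condition at `α`. -/
theorem exists_robin_solution (hαβ : α < β) (hρ : Continuous ρ) (hρ0 : ∀ r, 0 < ρ r)
    (hmono : Monotone ρ) {h : ℝ} (hh : h ≠ 0) :
    ∃ (τ : ℝ) (f p : ℝ → ℝ), τ ≠ 0 ∧ RadialSolution ρ α β τ f p ∧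
      (∀ r ∈ Set.Icc α β, 0 < f r) ∧ p α = h * f α := by
  have hsol := radialSolution_radialExt hαβ hρ hρ0
  have hαm : α ∈ Set.Icc α β := ⟨le_rfl, hαβ.le⟩
  set G : ℝ → ℝ := fun τ => radialDeriv ρ α β τ α - h * radialExt ρ α β τ α with hG
  have hGc : Continuous G := (continuous_radialDeriv_left hαβ hρ hρ0).sub
    (continuous_const.mul (continuous_radialExt_left hαβ hρ hρ0 hαm))
  have hG0 : G 0 = -h := by simp [hG, radialExt_zero, radialDeriv]
  suffices ∃ τ, G τ = 0 ∧ ∀ r ∈ Set.Icc α β, 0 < radialExt ρ α β τ r by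
    obtain ⟨τ, hτ, hpos⟩ := this
    refine ⟨τ, _, _, ?_, hsol τ, hpos, sub_eq_zero.1 hτ⟩
    rintro rfl
    exact hh (by linarith)
  -- For `h < 0`: `G 0 > 0`, `G ≤ 0` at a strongly negative `τ`, and solutions with `τ ≤ 0` are at
  -- least `1`. For `h > 0`: `G 0 < 0`, and `G T > 0` at the Dirichlet eigenvalue `T`, so the root
  -- lies below `T`, where the solution is positive.
  rcases lt_or_gt_of_ne hh with hneg | hpos
  · have hge : ∀ τ ≤ 0, ∀ r ∈ Set.Icc α β, 0 < radialExt ρ α β τ r := fun τ hτ r hr => by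
      rw [radialExt_eq hαβ hρ hρ0 τ hr]
      exact zero_lt_one.trans_le (one_le_radialFn hαβ hρ hρ0 hτ hr)
    set δ := min (β - α) (1 / (2 * -h)) with hδ
    have hk : 0 < -h := by linarith
    have hδ0 : 0 < δ := lt_min (by linarith) (by positivity)
    have hτ0 : -(2 * -h / δ) ≤ 0 := neg_nonpos.2 (by positivity)
    have h1 := (hsol (-(2 * -h / δ))).deriv_le_neg_mul hαβ hρ hρ0 hmono
      (fun r hr => (hge _ hτ0 r hr).le) hδ0 hk (min_le_left _ _) (by
        calc -h * δ ≤ -h * (1 / (2 * -h)) := mul_le_mul_of_nonneg_left (min_le_right _ _) hk.le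
          _ = 1 / 2 := by field_simp) rfl
    obtain ⟨τ, hτ, hτ'⟩ := intermediate_value_Icc hτ0 hGc.continuousOn
      (show (0 : ℝ) ∈ _ from ⟨by simp only [hG]; linarith, by rw [hG0]; linarith⟩)
    exact ⟨τ, hτ', hge τ hτ.2⟩
  · obtain ⟨T, hT0, hTα, hTnn, hTpos⟩ := exists_first_zero hαβ hρ hρ0
    have h1 : 0 < G T := by
      have := (hsol T).mul_deriv_pos hρ hρ0 hT0.ne' hTnn ⟨le_rfl, hαβ⟩
      simp only [hG, hTα, mul_zero, sub_zero]
      exact pos_of_mul_pos_right this hT0.le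
    obtain ⟨τ, hτ, hτ'⟩ := intermediate_value_Icc hT0.le hGc.continuousOn
      (show (0 : ℝ) ∈ _ from ⟨by rw [hG0]; linarith, h1.le⟩)
    refine ⟨τ, hτ', hTpos τ ⟨hτ.1, lt_of_le_of_ne hτ.2 ?_⟩⟩
    rintro rfl
    linarith

end shooting

/-! ### Polar coordinates, weak gradients and traces of `C¹` functions -/

section polar

variable {N : ℕ}

/-- Integration over a spherical shell in polar coordinates. -/
theorem setIntegral_annulus (hN : 2 ≤ N) {α β : ℝ} (hα : 0 < α) (hαβ : α < β) (c : Space N)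
    {G : Space N → ℝ} (hG : Continuous G) :
    ∫ x in Metric.ball c β \ Metric.closedBall c α, G x =
      ∫ s, (∫ r in α..β, r ^ (N - 1) * G (c + r • (s : Space N)))
        ∂(volume : Measure (Space N)).toSphere := by
  have : Nonempty (Fin N) := ⟨⟨0, by omega⟩⟩
  have : Nontrivial (Space N) := inferInstance
  have hmeas : MeasurableSet (Metric.ball c β \ Metric.closedBall c α) :=
    measurableSet_ball.diff measurableSet_closedBall
  set H : Space N → ℝ := fun y =>
    (Metric.ball c β \ Metric.closedBall c α).indicator G (c + y) with hH
  have hHint : Integrable H := by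
    have h1 : Integrable ((Metric.ball c β \ Metric.closedBall c α).indicator G) := by
      rw [integrable_indicator_iff hmeas]
      exact (hG.continuousOn.integrableOn_compact (isCompact_closedBall c β)).mono_set
        (Set.sdiff_subset.trans Metric.ball_subset_closedBall)
    exact h1.comp_add_left c
  have e1 : ∫ x in Metric.ball c β \ Metric.closedBall c α, G x = ∫ y, H y := by
    rw [← integral_indicator hmeas, hH, integral_add_left_eq_self]
  have hmp := (volume : Measure (Space N)).measurePreserving_homeomorphUnitSphereProd
  have hemb := (homeomorphUnitSphereProd (Space N)).measurableEmbedding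
  set K : Metric.sphere (0 : Space N) 1 × Set.Ioi (0 : ℝ) → ℝ :=
    fun q => H ((q.2 : ℝ) • (q.1 : Space N)) with hK
  have hKH : ∀ x : ({0}ᶜ : Set (Space N)), K (homeomorphUnitSphereProd (Space N) x) = H x := by
    intro x
    have : ((homeomorphUnitSphereProd (Space N)).symm
      (homeomorphUnitSphereProd (Space N) x) : Space N) = x := by simp
    rw [homeomorphUnitSphereProd_symm_apply_coe] at this
    simp only [hK, this]
  have hfr : Module.finrank ℝ (Space N) - 1 = N - 1 := by simp
  rw [hfr] at hmp
  have e2 : ∫ y, H y = ∫ q, K q ∂((volume : Measure (Space N)).toSphere.prod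
      (Measure.volumeIoiPow (N - 1))) := by
    rw [← hmp.integral_comp hemb]
    simp_rw [hKH]
    rw [integral_subtype_comap (measurableSet_singleton _).compl H, restrict_compl_singleton]
  have hKint : Integrable K ((volume : Measure (Space N)).toSphere.prod
      (Measure.volumeIoiPow (N - 1))) := by
    rw [← hmp.integrable_comp_emb hemb]
    have : K ∘ (homeomorphUnitSphereProd (Space N)) = H ∘ ((↑) : ({0}ᶜ : Set (Space N)) → _) :=
      funext hKH
    rw [this, ← integrableOn_iff_comap_subtypeVal (measurableSet_singleton _).compl]
    exact hHint.integrableOn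
  rw [e1, e2, integral_prod _ hKint]
  refine integral_congr_ae (ae_of_all _ fun s => ?_)
  have hs : ‖(s : Space N)‖ = 1 := by simp
  have e3 : ∫ r, K (s, r) ∂(Measure.volumeIoiPow (N - 1)) =
      ∫ r in Set.Ioi (0 : ℝ), r ^ (N - 1) * H (r • (s : Space N)) := by
    simp only [Measure.volumeIoiPow, ENNReal.ofReal]
    rw [integral_withDensity_eq_integral_smul (by fun_prop),
      integral_subtype_comap measurableSet_Ioi
        fun a => Real.toNNReal (a ^ (N - 1)) • H (a • (s : Space N))]
    refine setIntegral_congr_fun measurableSet_Ioi fun x hx => ?_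
    simp only [NNReal.smul_def, Real.coe_toNNReal _ (pow_nonneg (le_of_lt hx) _), smul_eq_mul]
  simp only [e3]
  have hmem : ∀ r ∈ Set.Ioi (0 : ℝ),
      (c + r • (s : Space N) ∈ Metric.ball c β \ Metric.closedBall c α ↔ r ∈ Set.Ioo α β) := by
    intro r hr
    have : ‖r • (s : Space N)‖ = r := by rw [norm_smul, hs, mul_one, Real.norm_of_nonneg hr.le]
    simp [dist_eq_norm, this, and_comm]
  have e4 : ∫ r in Set.Ioi (0 : ℝ), r ^ (N - 1) * H (r • (s : Space N)) =
      ∫ r in Set.Ioi (0 : ℝ), (Set.Ioo α β).indicator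
        (fun r => r ^ (N - 1) * G (c + r • (s : Space N))) r := by
    refine setIntegral_congr_fun measurableSet_Ioi fun r hr => ?_
    by_cases h : r ∈ Set.Ioo α β
    · simp only [hH, Set.indicator_of_mem h, Set.indicator_of_mem ((hmem r hr).2 h)]
    · simp only [hH, Set.indicator_of_notMem h,
        Set.indicator_of_notMem (fun h' => h ((hmem r hr).1 h')), mul_zero]
  rw [e4, setIntegral_indicator measurableSet_Ioo,
    Set.inter_eq_right.2 fun r (hr : r ∈ Set.Ioo α β) => Set.mem_Ioi.2 (hα.trans hr.1),
    intervalIntegral.integral_of_le hαβ.le, integral_Ioc_eq_integral_Ioo]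

theorem continuous_ray_integral {α β : ℝ} (c : Space N) {G : Space N → ℝ} (hG : Continuous G) :
    Continuous fun s : Metric.sphere (0 : Space N) 1 =>
      ∫ r in α..β, r ^ (N - 1) * G (c + r • (s : Space N)) :=
  intervalIntegral.continuous_parametric_intervalIntegral_of_continuous'
    (f := fun (s : Metric.sphere (0 : Space N) 1) r => r ^ (N - 1) * G (c + r • (s : Space N)))
    (by fun_prop) α β

theorem integrable_sphere {G : Metric.sphere (0 : Space N) 1 → ℝ} (hG : Continuous G) :
    Integrable G (volume : Measure (Space N)).toSphere := by
  rw [← integrableOn_univ]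
  exact hG.continuousOn.integrableOn_compact isCompact_univ

theorem integral_surfaceMeasure {r : ℝ} (hr : 0 ≤ r) (c : Space N) {G : Space N → ℝ}
    (hG : Continuous G) : ∫ x, G x ∂(surfaceMeasure c r) =
      r ^ (N - 1) * ∫ s, G (c + r • (s : Space N)) ∂(volume : Measure (Space N)).toSphere := by
  rw [surfaceMeasure, integral_smul_measure, integral_map (by fun_prop)
    hG.aestronglyMeasurable, ENNReal.toReal_ofReal (pow_nonneg hr _), smul_eq_mul]

theorem memLp_surfaceMeasure {r : ℝ} (c : Space N) {G : Space N → ℝ}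
    (hG : Continuous G) : MemLp G 2 (surfaceMeasure c r) := by
  refine MemLp.smul_measure ?_ ENNReal.ofReal_ne_top
  rw [memLp_map_measure_iff hG.aestronglyMeasurable (by fun_prop)]
  have hc : Continuous (G ∘ fun s : Metric.sphere (0 : Space N) 1 => c + r • (s : Space N)) := by
    fun_prop
  obtain ⟨C, hC⟩ := isCompact_univ.exists_bound_of_continuousOn hc.continuousOn
  exact MemLp.of_bound hc.aestronglyMeasurable C (ae_of_all _ fun s => hC s trivial)

theorem memLp_restrict_of_continuous {E : Type*} [NormedAddCommGroup E] {Ω : Set (Space N)}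
    {R : ℝ} (hΩ : MeasurableSet Ω) (hR : Ω ⊆ Metric.closedBall 0 R) {G : Space N → E}
    (hG : Continuous G) : MemLp G 2 (volume.restrict Ω) := by
  obtain ⟨C, hC⟩ := (isCompact_closedBall (0 : Space N) R).exists_bound_of_continuousOn
    hG.continuousOn
  have : IsFiniteMeasure (volume.restrict Ω) :=
    ⟨by
      rw [Measure.restrict_apply_univ]
      exact (measure_mono hR).trans_lt measure_closedBall_lt_top⟩
  refine MemLp.of_bound hG.aestronglyMeasurable C ?_
  filter_upwards [ae_restrict_mem hΩ] with x hx using hC x (hR hx)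

theorem norm_gradient (φ : Space N → ℝ) (x : Space N) : ‖gradient φ x‖ = ‖fderiv ℝ φ x‖ := by
  simp [gradient]

theorem continuous_gradient {φ : Space N → ℝ} (hφ : ContDiff ℝ 1 φ) :
    Continuous (gradient φ) :=
  (InnerProductSpace.toDual ℝ (Space N)).symm.continuous.comp (hφ.continuous_fderiv one_ne_zero)

theorem inner_gradient {φ : Space N → ℝ} (x v : Space N) :
    inner ℝ v (gradient φ x) = fderiv ℝ φ x v := by
  rw [real_inner_comm, gradient, InnerProductSpace.toDual_symm_apply]

theorem hasWeakGradient_gradient {Ω : Set (Space N)} {u : Space N → ℝ} (hu : ContDiff ℝ 1 u) :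
    HasWeakGradient Ω u (gradient u) := by
  intro φ hφ hc hΩ
  have hφ1 : ContDiff ℝ 1 φ := hφ.of_le (by exact_mod_cast le_top)
  have hg0 : ∀ x, x ∉ tsupport φ → gradient φ x = 0 := by
    intro x hx
    have : fderiv ℝ φ x = 0 := by
      by_contra h
      exact hx (support_fderiv_subset ℝ h)
    rw [← norm_eq_zero, norm_gradient, this, norm_zero]
  have hgc : HasCompactSupport (gradient φ) := HasCompactSupport.intro hc hg0
  have h1 : ∫ x in Ω, u x • gradient φ x = ∫ x, u x • gradient φ x := by
    refine setIntegral_eq_integral_of_forall_compl_eq_zero fun x hx => ?_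
    rw [hg0 x fun h => hx (hΩ h), smul_zero]
  have h2 : ∫ x in Ω, φ x • gradient u x = ∫ x, φ x • gradient u x := by
    refine setIntegral_eq_integral_of_forall_compl_eq_zero fun x hx => ?_
    rw [image_eq_zero_of_notMem_tsupport fun h => hx (hΩ h), zero_smul]
  rw [h1, h2]
  have hug := continuous_gradient hu
  have hφg := continuous_gradient hφ1
  have hi1 : Integrable fun x => u x • gradient φ x :=
    (hu.continuous.smul hφg).integrable_of_hasCompactSupport hgc.smul_left
  have hi2 : Integrable fun x => φ x • gradient u x :=
    (hφ.continuous.smul hug).integrable_of_hasCompactSupport hc.smul_right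
  refine ext_inner_left ℝ fun v => ?_
  rw [inner_neg_right, ← integral_inner hi1, ← integral_inner hi2]
  simp only [inner_smul_right, inner_gradient]
  have := integral_mul_fderiv_eq_neg_fderiv_mul_of_integrable (μ := volume) (f := u) (g := φ)
    (v := v) ?_ ?_ ?_ (fun x _ => hu.differentiable one_ne_zero x)
    (fun x _ => hφ1.differentiable one_ne_zero x)
  · rw [this]; simp only [mul_comm]
  · simpa [inner_smul_right, inner_gradient, mul_comm] using hi2.const_inner (𝕜 := ℝ) v
  · simpa [inner_smul_right, inner_gradient] using hi1.const_inner (𝕜 := ℝ) v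
  · exact (hu.continuous.mul hφ.continuous).integrable_of_hasCompactSupport hc.mul_left

theorem memH1_of_contDiff {Ω : Set (Space N)} {R : ℝ} (hΩ : MeasurableSet Ω)
    (hR : Ω ⊆ Metric.closedBall 0 R) {u : Space N → ℝ} (hu : ContDiff ℝ 1 u) :
    MemH1 Ω u (gradient u) :=
  ⟨memLp_restrict_of_continuous hΩ hR hu.continuous,
    memLp_restrict_of_continuous hΩ hR (continuous_gradient hu), hasWeakGradient_gradient hu⟩

theorem isTraceOnSphere_of_contDiff {Ω : Set (Space N)} {u : Space N → ℝ} (hu : ContDiff ℝ 1 u)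
    (c : Space N) (r : ℝ) : IsTraceOnSphere Ω c r u (gradient u) u :=
  ⟨memLp_surfaceMeasure c hu.continuous, fun _ => u, fun _ => hu, by simp, by simp, by simp⟩

/-- Used to pass the energy bound from `C¹` approximations to a Sobolev function, its weak gradient
and its trace. -/
theorem tendsto_integral_norm_sq {X E : Type*} [MeasurableSpace X] [NormedAddCommGroup E]
    {μ : Measure X} {f : X → E} {φ : ℕ → X → E} (hf : MemLp f 2 μ) (hφ : ∀ n, MemLp (φ n) 2 μ)
    (h : Tendsto (fun n => eLpNorm (φ n - f) 2 μ) atTop (𝓝 0)) :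
    Tendsto (fun n => ∫ x, ‖φ n x‖ ^ 2 ∂μ) atTop (𝓝 (∫ x, ‖f x‖ ^ 2 ∂μ)) := by
  have key : ∀ {g : X → E} (hg : MemLp g 2 μ), ∫ x, ‖g x‖ ^ 2 ∂μ = ‖hg.toLp g‖ ^ 2 := by
    intro g hg
    have h0 : 0 ≤ ∫ x, ‖g x‖ ^ 2 ∂μ := integral_nonneg fun x => by positivity
    rw [Lp.norm_toLp, hg.eLpNorm_eq_integral_rpow_norm two_ne_zero ENNReal.ofNat_ne_top,
      ENNReal.toReal_ofReal (by positivity)]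
    simp only [ENNReal.toReal_ofNat, Real.rpow_ofNat, ← one_div, ← Real.sqrt_eq_rpow]
    rw [Real.sq_sqrt h0]
  rw [key hf]
  simp_rw [fun n => key (hφ n)]
  exact (((Lp.tendsto_Lp_iff_tendsto_eLpNorm'' φ hφ f hf).2 h).norm).pow 2

end polar

/-- The weight `t ^ (N - 1)` of polar coordinates, made positive on `ℝ`. -/
def polarWeight (N : ℕ) (α t : ℝ) : ℝ := (max t α) ^ (N - 1)

theorem continuous_polarWeight (N : ℕ) (α : ℝ) : Continuous (polarWeight N α) := by
  unfold polarWeight; fun_prop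

theorem polarWeight_pos (N : ℕ) {α : ℝ} (hα : 0 < α) (t : ℝ) : 0 < polarWeight N α t :=
  pow_pos (hα.trans_le (le_max_right _ _)) _

theorem monotone_polarWeight (N : ℕ) {α : ℝ} (hα : 0 < α) : Monotone (polarWeight N α) :=
  fun _ _ h => pow_le_pow_left₀ (hα.le.trans (le_max_right _ _)) (max_le_max_right _ h) _

theorem polarWeight_self (N : ℕ) (α : ℝ) : polarWeight N α α = α ^ (N - 1) := by
  simp [polarWeight]

theorem integral_polarWeight_mul (N : ℕ) {α β : ℝ} (hαβ : α < β) (g : ℝ → ℝ) :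
    ∫ r in α..β, polarWeight N α r * g r = ∫ r in α..β, r ^ (N - 1) * g r := by
  refine intervalIntegral.integral_congr fun r hr => ?_
  rw [Set.uIcc_of_le hαβ.le] at hr
  simp only [polarWeight, max_eq_left hr.1]

/-! ### Lower bound in the concentric shell -/

variable {N : ℕ} {α β τ : ℝ} {f p : ℝ → ℝ}

theorem measurableSet_shell (x₀ : Space N) : MeasurableSet (shell β α x₀) :=
  measurableSet_ball.diff isClosed_closure.measurableSet

theorem shell_subset (x₀ : Space N) : shell β α x₀ ⊆ Metric.closedBall 0 β :=
  Set.sdiff_subset.trans Metric.ball_subset_closedBall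

theorem shell_eq (hα : 0 < α) (x₀ : Space N) :
    shell β α x₀ = Metric.ball 0 β \ Metric.closedBall x₀ α := by
  rw [shell, closure_ball _ hα.ne']

/-- The lower bound for the energy of a `C¹` function in a concentric shell. -/
theorem RadialSolution.energy_lower_bound_of_contDiff (hN : 2 ≤ N) (hα : 0 < α) (hαβ : α < β)
    (hsol : RadialSolution (polarWeight N α) α β τ f p) (hpos : ∀ r ∈ Set.Icc α β, 0 < f r)
    {φ : Space N → ℝ} (hφ : ContDiff ℝ 1 φ) :
    τ * ∫ x in shell β α 0, φ x ^ 2 ≤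
      (∫ x in shell β α 0, ‖gradient φ x‖ ^ 2) +
        p α / f α * ∫ x, φ x ^ 2 ∂(surfaceMeasure 0 α) := by
  have hφc := hφ.continuous
  have hgc := continuous_gradient hφ
  have hG1 : Continuous fun x => φ x ^ 2 := by fun_prop
  have hG2 : Continuous fun x => ‖gradient φ x‖ ^ 2 := by fun_prop
  rw [shell_eq hα, setIntegral_annulus hN hα hαβ 0 hG1, setIntegral_annulus hN hα hαβ 0 hG2,
    integral_surfaceMeasure hα.le 0 hG1, ← integral_const_mul, ← integral_const_mul,
    ← integral_const_mul]
  have hi1 := integrable_sphere (continuous_ray_integral (α := α) (β := β) 0 hG1)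
  have hi2 := integrable_sphere (continuous_ray_integral (α := α) (β := β) 0 hG2)
  have hi3 : Integrable (fun s : Metric.sphere (0 : Space N) 1 =>
      p α / f α * (α ^ (N - 1) * φ (0 + α • (s : Space N)) ^ 2))
      (volume : Measure (Space N)).toSphere := integrable_sphere (by fun_prop)
  rw [← integral_add hi2 hi3]
  refine integral_mono (hi1.const_mul τ) (hi2.add hi3) fun s => ?_
  have hs : ‖(s : Space N)‖ = 1 := by simp
  have hray : ∀ r : ℝ,
      HasDerivAt (fun r : ℝ => (0 : Space N) + r • (s : Space N)) (s : Space N) r :=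
    fun r => by simpa using ((hasDerivAt_id r).smul_const (s : Space N)).const_add (0 : Space N)
  have hψ : ∀ r, HasDerivAt (fun r : ℝ => φ (0 + r • (s : Space N)))
      (fderiv ℝ φ (0 + r • (s : Space N)) s) r := fun r =>
    (hφ.differentiable one_ne_zero _).hasFDerivAt.comp_hasDerivAt r (hray r)
  have hψ' : Continuous fun r : ℝ => fderiv ℝ φ (0 + r • (s : Space N)) s :=
    ((hφ.continuous_fderiv one_ne_zero).comp (by fun_prop)).clm_apply continuous_const
  -- Picone's inequality on the ray through `s`; the radial derivative is then bounded by the full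
  -- gradient.
  have key := hsol.picone hαβ (continuous_polarWeight N α) (polarWeight_pos N hα) hpos hψ hψ'
  rw [integral_polarWeight_mul N hαβ, integral_polarWeight_mul N hαβ, polarWeight_self] at key
  refine key.trans (add_le_add_left ?_ _)
  refine intervalIntegral.integral_mono_on hαβ.le
    (Continuous.intervalIntegrable (by fun_prop) _ _)
    (Continuous.intervalIntegrable (by fun_prop) _ _) fun r hr => ?_
  have hr0 : 0 ≤ r := hα.le.trans hr.1
  refine mul_le_mul_of_nonneg_left ?_ (pow_nonneg hr0 _)
  rw [norm_gradient, ← sq_abs]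
  refine pow_le_pow_left₀ (abs_nonneg _) ?_ 2
  simpa [hs] using (fderiv ℝ φ (0 + r • (s : Space N))).le_opNorm s

/-- The lower bound for the energy of a Sobolev function in a concentric shell. -/
theorem RadialSolution.energy_lower_bound (hN : 2 ≤ N) (hα : 0 < α) (hαβ : α < β)
    (hsol : RadialSolution (polarWeight N α) α β τ f p) (hpos : ∀ r ∈ Set.Icc α β, 0 < f r)
    {u : Space N → ℝ} {w : Space N → Space N} {g : Space N → ℝ} (hu : MemH1 (shell β α 0) u w)
    (hg : IsTraceOnSphere (shell β α 0) 0 α u w g) :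
    τ * ∫ x in shell β α 0, u x ^ 2 ≤
      (∫ x in shell β α 0, ‖w x‖ ^ 2) + p α / f α * ∫ x, g x ^ 2 ∂(surfaceMeasure 0 α) := by
  obtain ⟨φ, hφ, h1, h2, h3⟩ := hg.exists_approx
  have hm := measurableSet_shell (N := N) (α := α) (β := β) 0
  have t1 := tendsto_integral_norm_sq hu.memLp
    (fun n => memLp_restrict_of_continuous hm (shell_subset 0) (hφ n).continuous) h1
  have t2 := tendsto_integral_norm_sq hu.memLp_grad
    (fun n => memLp_restrict_of_continuous hm (shell_subset 0) (continuous_gradient (hφ n))) h2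
  have t3 := tendsto_integral_norm_sq hg.memLp
    (fun n => memLp_surfaceMeasure 0 (hφ n).continuous) h3
  simp only [Real.norm_eq_abs, sq_abs] at t1 t3
  exact le_of_tendsto_of_tendsto' (t1.const_mul τ) (t2.add (t3.const_mul _)) fun n =>
    hsol.energy_lower_bound_of_contDiff hN hα hαβ hpos (hφ n)

theorem setIntegral_sq_pos {Ω : Set (Space N)} {u : Space N → ℝ}
    (hu : MemLp u 2 (volume.restrict Ω)) (hne : ¬ u =ᵐ[volume.restrict Ω] 0) :
    0 < ∫ x in Ω, u x ^ 2 := by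
  refine lt_of_le_of_ne (integral_nonneg fun x => sq_nonneg _) fun h => hne ?_
  have := (integral_eq_zero_iff_of_nonneg (fun x => sq_nonneg (u x)) hu.integrable_sq).1 h.symm
  filter_upwards [this] with x hx
  simpa using hx

/-- The radial first eigenfunction of the concentric shell. -/
theorem exists_radial_eigenfunction (hN : 2 ≤ N) (hα : 0 < α) (hαβ : α < β) {h : WithTop ℝ}
    (hh : h ≠ 0) : ∃ (τ : ℝ) (f p : ℝ → ℝ), τ ≠ 0 ∧
      RadialSolution (polarWeight N α) α β τ f p ∧ (∀ r ∈ Set.Icc α β, 0 ≤ f r) ∧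
      p α * f α = h.untopD 0 * f α ^ 2 ∧ (h = ⊤ → f α = 0) ∧
      ∀ q ∈ rayleighValues h (shell β α (0 : Space N)) 0 α, τ ≤ q := by
  have hρ := continuous_polarWeight N α
  have hρ0 := polarWeight_pos N hα
  induction h with
  | top =>
    obtain ⟨T, hT0, hTα, hTnn, hTpos⟩ := exists_first_zero hαβ hρ hρ0
    -- With the boundary condition multiplied by `f α`, both sides vanish in the Dirichlet case.
    refine ⟨T, _, _, hT0.ne', radialSolution_radialExt hαβ hρ hρ0 T, hTnn, by simp [hTα],
      fun _ => hTα, ?_⟩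
    rintro q ⟨u, w, g, hu, hg, hne, htop, rfl⟩
    have hD := setIntegral_sq_pos hu.memLp hne
    simp only [WithTop.untopD_top, zero_mul, add_zero]
    have hnum : 0 ≤ ∫ x in shell β α 0, ‖w x‖ ^ 2 := integral_nonneg fun x => by positivity
    have hg0 : ∫ x, g x ^ 2 ∂(surfaceMeasure 0 α) = 0 := by
      refine integral_eq_zero_of_ae ?_
      filter_upwards [htop rfl] with x hx
      simp [hx]
    -- At `T` itself the solution vanishes at `α` and Picone's inequality does not apply. It applies
    -- for every `τ` in `[0, T)`, where the zero trace removes the boundary term.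
    have hle : ∀ τ ∈ Set.Ico 0 T,
        τ ≤ (∫ x in shell β α 0, ‖w x‖ ^ 2) / ∫ x in shell β α 0, u x ^ 2 := by
      intro τ hτ
      rw [le_div_iff₀ hD]
      have := (radialSolution_radialExt hαβ hρ hρ0 τ).energy_lower_bound hN hα hαβ (hTpos τ hτ)
        hu hg
      rwa [hg0, mul_zero, add_zero] at this
    have hq := div_nonneg hnum hD.le
    by_contra! hlt
    -- The midpoint of the quotient and `T` lies in `[0, T)` because the quotient is nonnegative.
    have := hle (((∫ x in shell β α 0, ‖w x‖ ^ 2) / (∫ x in shell β α 0, u x ^ 2) + T) / 2)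
      ⟨by linarith, by linarith⟩
    linarith
  | coe h =>
    have hh' : h ≠ 0 := by exact_mod_cast hh
    obtain ⟨τ, f, p, hτ, hsol, hpos, hbc⟩ :=
      exists_robin_solution hαβ hρ hρ0 (monotone_polarWeight N hα) hh'
    have hfα := hpos α ⟨le_rfl, hαβ.le⟩
    refine ⟨τ, f, p, hτ, hsol, fun r hr => (hpos r hr).le, ?_, fun hc => by simp at hc, ?_⟩
    · rw [hbc, WithTop.untopD_coe]; ring
    · rintro q ⟨u, w, g, hu, hg, hne, -, rfl⟩
      rw [le_div_iff₀ (setIntegral_sq_pos hu.memLp hne), WithTop.untopD_coe]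
      have := hsol.energy_lower_bound hN hα hαβ hpos hu hg
      rwa [hbc, mul_div_cancel_right₀ _ hfα.ne'] at this

/-! ### Transplantation to the eccentric shell -/

/-- The radial solution as a `C¹` function on the space. -/
theorem exists_radial_function (hN : 2 ≤ N) (hα : 0 < α) {ρ : ℝ → ℝ}
    (hsol : RadialSolution ρ α β τ f p) (c : Space N) :
    ∃ u : Space N → ℝ, ContDiff ℝ 1 u ∧
      ∀ x, α ≤ ‖x - c‖ → u x = f ‖x - c‖ ∧ ‖gradient u x‖ = |p ‖x - c‖| := by
  have : Nonempty (Fin N) := ⟨⟨0, by omega⟩⟩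
  have : Nontrivial (Space N) := inferInstance
  have hf : ContDiff ℝ 1 f := by
    rw [contDiff_one_iff_deriv]
    refine ⟨fun r => (hsol.hasDerivAt r).differentiableAt, ?_⟩
    rw [show deriv f = p from funext fun r => (hsol.hasDerivAt r).deriv]
    exact hsol.continuous_deriv
  -- The cutoff removes the singularity of the norm at `c` and changes nothing where `‖x - c‖ ≥ α`.
  let η : ContDiffBump c := ⟨α / 3, α / 2, by linarith, by linarith⟩
  have hout : ∀ x, α ≤ ‖x - c‖ → (fun y => (1 - η y) * f ‖y - c‖) =ᶠ[𝓝 x]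
      fun y => f ‖y - c‖ := by
    intro x hx
    have hU : {y : Space N | α / 2 < ‖y - c‖} ∈ 𝓝 x :=
      (isOpen_lt continuous_const (by fun_prop)).mem_nhds (by
        simp only [Set.mem_ofPred_eq]; linarith)
    filter_upwards [hU] with y hy
    rw [η.zero_of_le_dist (by rw [dist_eq_norm]; exact le_of_lt hy), sub_zero, one_mul]
  refine ⟨fun x => (1 - η x) * f ‖x - c‖, ?_, fun x hx => ⟨(hout x hx).self_of_nhds, ?_⟩⟩
  · rw [contDiff_iff_contDiffAt]
    intro x
    rcases eq_or_ne x c with rfl | hx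
    · refine (contDiffAt_const (c := (0 : ℝ))).congr_of_eventuallyEq ?_
      filter_upwards [η.eventuallyEq_one] with y hy
      simp [hy]
    · exact (contDiffAt_const.sub η.contDiff.contDiffAt).mul
        (hf.contDiffAt.comp x ((contDiffAt_id.sub contDiffAt_const).norm ℝ (sub_ne_zero.2 hx)))
  · have hxc : x - c ≠ 0 := by
      rw [← norm_pos_iff]; linarith
    have hd : DifferentiableAt ℝ (fun y : Space N => ‖y‖) (x - c) :=
      (contDiffAt_norm ℝ hxc).differentiableAt one_ne_zero
    have h1 : HasFDerivAt (fun y : Space N => ‖y - c‖) (fderiv ℝ (fun y : Space N => ‖y‖) (x - c))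
        x :=
      (hd.hasFDerivAt.comp x ((hasFDerivAt_id x).sub_const c)).congr_fderiv
        (ContinuousLinearMap.comp_id _)
    have h2 := ((hsol.hasDerivAt ‖x - c‖).comp_hasFDerivAt x h1).congr_of_eventuallyEq (hout x hx)
    rw [norm_gradient, h2.fderiv, norm_smul, norm_fderiv_norm hd, mul_one, Real.norm_eq_abs]

theorem setIntegral_annulus_radial (hN : 2 ≤ N) (hα : 0 < α) (hαβ : α < β) (c : Space N)
    {G : Space N → ℝ} (hG : Continuous G) {g : ℝ → ℝ} (hg : ∀ x, α ≤ ‖x - c‖ → G x = g ‖x - c‖) :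
    ∫ x in Metric.ball c β \ Metric.closedBall c α, G x =
      (volume : Measure (Space N)).toSphere.real Set.univ *
        ∫ r in α..β, polarWeight N α r * g r := by
  rw [setIntegral_annulus hN hα hαβ c hG, integral_polarWeight_mul N hαβ, ← smul_eq_mul,
    ← integral_const]
  refine integral_congr_ae (ae_of_all _ fun s => ?_)
  refine intervalIntegral.integral_congr fun r hr => ?_
  rw [Set.uIcc_of_le hαβ.le] at hr
  have hs : ‖c + r • (s : Space N) - c‖ = r := by
    rw [add_sub_cancel_left, norm_smul, norm_eq_of_mem_sphere, mul_one,
      Real.norm_of_nonneg (hα.le.trans hr.1)]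
  simp only [hg (c + r • (s : Space N)) (by rw [hs]; exact hr.1), hs]

theorem integral_surfaceMeasure_radial (hα : 0 < α) (c : Space N)
    {G : Space N → ℝ} (hG : Continuous G) {g : ℝ → ℝ} (hg : ∀ x, α ≤ ‖x - c‖ → G x = g ‖x - c‖) :
    ∫ x, G x ∂(surfaceMeasure c α) =
      (volume : Measure (Space N)).toSphere.real Set.univ * (polarWeight N α α * g α) := by
  have : ∀ s : Metric.sphere (0 : Space N) 1, G (c + α • (s : Space N)) = g α := by
    intro s
    have hs : ‖c + α • (s : Space N) - c‖ = α := by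
      rw [add_sub_cancel_left, norm_smul, norm_eq_of_mem_sphere, mul_one,
        Real.norm_of_nonneg hα.le]
    rw [hg (c + α • (s : Space N)) (by rw [hs]), hs]
  rw [integral_surfaceMeasure hα.le c hG]
  simp_rw [this]
  rw [integral_const, smul_eq_mul, polarWeight_self]
  ring

/-- The first eigenfunction of the concentric shell, transplanted to an eccentric shell, has a
smaller Rayleigh quotient. -/
theorem exists_rayleighValue_lt (hN : 2 ≤ N) (hα : 0 < α) (hαβ : α < β) {h : WithTop ℝ}
    {x₀ : Space N} (hx₀ : closure (Metric.ball x₀ α) ⊆ Metric.ball 0 β) (hne : x₀ ≠ 0)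
    (hτ : τ ≠ 0) (hsol : RadialSolution (polarWeight N α) α β τ f p)
    (hnn : ∀ r ∈ Set.Icc α β, 0 ≤ f r) (hbc : p α * f α = h.untopD 0 * f α ^ 2)
    (htop : h = ⊤ → f α = 0) : ∃ q ∈ rayleighValues h (shell β α x₀) x₀ α, q < τ := by
  have hρ := continuous_polarWeight N α
  have hρ0 := polarWeight_pos N hα
  obtain ⟨u, hu, hux⟩ := exists_radial_function hN hα hsol x₀
  have hD : Continuous fun x => ‖gradient u x‖ ^ 2 := by
    have := continuous_gradient hu; fun_prop
  have hU : Continuous fun x => u x ^ 2 := hu.continuous.pow 2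
  have hDr : ∀ x, α ≤ ‖x - x₀‖ → ‖gradient u x‖ ^ 2 = p ‖x - x₀‖ ^ 2 := fun x hx => by
    rw [(hux x hx).2, sq_abs]
  have hUr : ∀ x, α ≤ ‖x - x₀‖ → u x ^ 2 = f ‖x - x₀‖ ^ 2 := fun x hx => by rw [(hux x hx).1]
  rw [closure_ball _ hα.ne'] at hx₀
  set Ω := shell β α x₀ with hΩ
  have hΩe : Ω = Metric.ball 0 β \ Metric.closedBall x₀ α := shell_eq hα x₀
  have hΩm : MeasurableSet Ω := measurableSet_shell x₀
  set A := Metric.ball x₀ β \ Metric.closedBall x₀ α with hA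
  have hAm : MeasurableSet A := measurableSet_ball.diff measurableSet_closedBall
  have hout : ∀ x, x ∉ Metric.closedBall x₀ α → α ≤ ‖x - x₀‖ := by
    intro x hx
    rw [Metric.mem_closedBall, dist_eq_norm, not_le] at hx
    exact hx.le
  have hintΩ : ∀ {G : Space N → ℝ}, Continuous G → IntegrableOn G Ω := fun hG =>
    (hG.continuousOn.integrableOn_compact (isCompact_closedBall 0 β)).mono_set (shell_subset x₀)
  have hintA : ∀ {G : Space N → ℝ}, Continuous G → IntegrableOn G A := fun hG =>
    (hG.continuousOn.integrableOn_compact (isCompact_closedBall x₀ β)).mono_set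
      (Set.sdiff_subset.trans Metric.ball_subset_closedBall)
  have hsplit : ∀ {G : Space N → ℝ}, Continuous G →
      ∫ x in Ω, G x = (∫ x in A, G x) - (∫ x in A \ Ω, G x) + ∫ x in Ω \ A, G x := by
    intro G hG
    have h1 := integral_inter_add_sdiff hΩm (hintA hG)
    have h2 := integral_inter_add_sdiff hAm (hintΩ hG)
    rw [Set.inter_comm] at h2
    linarith
  -- `Ω` and `A` have equal volume: each is a ball of radius `β` without the same smaller ball
  -- contained in it.
  have hvol : ∫ x in Ω \ A, (1 : ℝ) = ∫ x in A \ Ω, (1 : ℝ) := by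
    have h1 := hsplit (G := fun _ => (1 : ℝ)) continuous_const
    have h2 : ∫ x in Ω, (1 : ℝ) = ∫ x in A, (1 : ℝ) := by
      have hsub : Metric.closedBall x₀ α ⊆ Metric.ball x₀ β := Metric.closedBall_subset_ball hαβ
      rw [setIntegral_const, setIntegral_const, hΩe, hA, measureReal_def, measureReal_def,
        measure_sdiff hx₀ measurableSet_closedBall.nullMeasurableSet
          measure_closedBall_lt_top.ne,
        measure_sdiff hsub measurableSet_closedBall.nullMeasurableSet
          measure_closedBall_lt_top.ne, Measure.addHaar_ball_center volume x₀]
    linarith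
  have hEpos : 0 < volume (A \ Ω) := by
    have hsub : Metric.ball x₀ β \ Metric.closedBall 0 β ⊆ A \ Ω := by
      rintro x ⟨hx1, hx2⟩
      have hx3 : x ∉ Metric.ball 0 β := fun h => hx2 (Metric.ball_subset_closedBall h)
      refine ⟨⟨hx1, fun h => hx3 (hx₀ h)⟩, fun h => ?_⟩
      rw [hΩe] at h
      exact hx3 h.1
    refine lt_of_lt_of_le ?_ (measure_mono hsub)
    refine (Metric.isOpen_ball.sdiff Metric.isClosed_closedBall).measure_pos volume ?_
    have hn : 0 < ‖x₀‖ := norm_pos_iff.2 hne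
    -- The witness is at distance `t < β` from `x₀`, straight away from the origin, so its norm is
    -- at least `β + ‖x₀‖ / 2`. The maximum with `0` spares a bound on `‖x₀‖`.
    set t := max 0 (β - ‖x₀‖ / 2) with ht
    have ht0 : 0 ≤ t := le_max_left _ _
    refine ⟨x₀ + (t / ‖x₀‖) • x₀, ?_, ?_⟩
    · rw [Metric.mem_ball, dist_eq_norm, add_sub_cancel_left, norm_smul,
        Real.norm_of_nonneg (by positivity), div_mul_cancel₀ _ hn.ne']
      exact max_lt (hα.trans hαβ) (by linarith)
    · have e : x₀ + (t / ‖x₀‖) • x₀ = (1 + t / ‖x₀‖) • x₀ := by rw [add_smul, one_smul]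
      rw [mem_closedBall_zero_iff, e, norm_smul, Real.norm_of_nonneg (by positivity), add_mul,
        div_mul_cancel₀ _ hn.ne', one_mul, not_le]
      have := le_max_right 0 (β - ‖x₀‖ / 2)
      rw [← ht] at this
      linarith
  have hUout : ∫ x in Ω \ A, u x ^ 2 = ∫ x in Ω \ A, (1 : ℝ) := by
    refine setIntegral_congr_fun (hΩm.diff hAm) fun x hx => ?_
    rw [hΩe] at hx
    have hβ : β ≤ ‖x - x₀‖ := by
      by_contra! hlt
      exact hx.2 ⟨by rwa [Metric.mem_ball, dist_eq_norm], hx.1.2⟩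
    simp only [hUr x (hout x hx.1.2), hsol.eq_one _ hβ, one_pow]
  have hDout : ∫ x in Ω \ A, ‖gradient u x‖ ^ 2 = 0 := by
    refine setIntegral_eq_zero_of_forall_eq_zero fun x hx => ?_
    rw [hΩe] at hx
    have hβ : β ≤ ‖x - x₀‖ := by
      by_contra! hlt
      exact hx.2 ⟨by rwa [Metric.mem_ball, dist_eq_norm], hx.1.2⟩
    have hp0 : p ‖x - x₀‖ = 0 := by
      rcases hβ.eq_or_lt with he | hlt
      · have := hsol.flux_eq β ⟨hαβ.le, le_rfl⟩
        rw [intervalIntegral.integral_same, mul_zero] at this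
        rw [← he]
        exact (mul_eq_zero.1 this).resolve_left (hρ0 β).ne'
      · exact hsol.deriv_eq_zero_of_lt hlt
    rw [hDr x (hout x hx.1.2), hp0]
    ring
  have henergy : (∫ x in A, ‖gradient u x‖ ^ 2) +
      h.untopD 0 * ∫ x, u x ^ 2 ∂(surfaceMeasure x₀ α) = τ * ∫ x in A, u x ^ 2 := by
    rw [setIntegral_annulus_radial hN hα hαβ x₀ hD (g := fun r => p r ^ 2) hDr,
      setIntegral_annulus_radial hN hα hαβ x₀ hU (g := fun r => f r ^ 2) hUr,
      integral_surfaceMeasure_radial hα x₀ hU (g := fun r => f r ^ 2) hUr]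
    have := hsol.energy hαβ hρ
    rw [mul_assoc, hbc] at this
    linear_combination (volume : Measure (Space N)).toSphere.real Set.univ * this
  have hDE : 0 ≤ ∫ x in A \ Ω, ‖gradient u x‖ ^ 2 := integral_nonneg fun x => by positivity
  have hUE : 0 < ∫ x in A \ Ω, -(τ * (u x ^ 2 - 1)) := by
    have hpos : ∀ x ∈ A \ Ω, 0 < -(τ * (u x ^ 2 - 1)) := by
      rintro x ⟨⟨hx1, hx2⟩, -⟩
      rw [Metric.mem_ball, dist_eq_norm] at hx1
      rw [hUr x (hout x hx2)]
      exact neg_pos.2 (hsol.mul_sq_sub_one_neg hρ hρ0 hτ hnn ⟨hout x hx2, hx1⟩)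
    rw [setIntegral_pos_iff_support_of_nonneg_ae]
    · have hsupp : A \ Ω ⊆ Function.support fun x => -(τ * (u x ^ 2 - 1)) :=
        fun x hx => Function.mem_support.2 (hpos x hx).ne'
      rwa [Set.inter_eq_right.2 hsupp]
    · filter_upwards [ae_restrict_mem (hAm.diff hΩm)] with x hx using (hpos x hx).le
    · exact (hintA (by fun_prop)).mono_set Set.sdiff_subset
  have hUE' : ∫ x in A \ Ω, -(τ * (u x ^ 2 - 1)) =
      -(τ * ((∫ x in A \ Ω, u x ^ 2) - ∫ x in A \ Ω, (1 : ℝ))) := by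
    rw [integral_neg, integral_const_mul, integral_sub ((hintA hU).mono_set Set.sdiff_subset)
      ((hintA continuous_const).mono_set Set.sdiff_subset)]
  rw [hUE'] at hUE
  -- `u = 1` on `Ω \ A`, a set of positive volume.
  have hpos : 0 < ∫ x in Ω, u x ^ 2 := by
    have h1 : 0 < ∫ x in A \ Ω, (1 : ℝ) := by
      rw [setIntegral_const, smul_eq_mul, mul_one, measureReal_def]
      exact ENNReal.toReal_pos hEpos.ne' ((measure_mono
        (Set.sdiff_subset.trans Set.sdiff_subset)).trans_lt measure_ball_lt_top).ne
    rw [← hvol, ← hUout] at h1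
    exact h1.trans_le (setIntegral_mono_set (hintΩ hU) (ae_of_all _ fun x => sq_nonneg _)
      (ae_of_all _ fun x hx => hx.1))
  refine ⟨_, ⟨u, gradient u, u, memH1_of_contDiff hΩm (shell_subset x₀) hu,
    isTraceOnSphere_of_contDiff hu x₀ α, fun h0 => ?_, fun ht => ?_, rfl⟩, ?_⟩
  · refine hpos.ne' (integral_eq_zero_of_ae ?_)
    filter_upwards [h0] with x hx
    simp [hx]
  · have h0 : ∫ x, u x ^ 2 ∂(surfaceMeasure x₀ α) = 0 := by
      rw [integral_surfaceMeasure_radial hα x₀ hU (g := fun r => f r ^ 2) hUr, htop ht]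
      simp
    have := (integral_eq_zero_iff_of_nonneg (fun x => sq_nonneg (u x))
      (memLp_surfaceMeasure x₀ hu.continuous).integrable_sq).1 h0
    filter_upwards [this] with x hx
    simpa using hx
  -- The energy on `Ω` is at most that on `A`, which is `τ ∫_A u²`; and `τ ∫_Ω u²` exceeds this by
  -- `-τ ∫_{A \ Ω} (u² - 1) > 0`.
  · rw [div_lt_iff₀ hpos, hsplit hD, hsplit hU, hUout, hDout, hvol]
    linarith

end RobinShell

end
theorem mainTheorem2 (N : ℕ) (hN : 2 ≤ N) (h : WithTop ℝ) (hh : h ≠ 0)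
    (α β : ℝ) (hα : 0 < α) (hαβ : α < β)
    (x₀ : EuclideanSpace ℝ (Fin N))
    (hx₀ : closure (Metric.ball x₀ α) ⊆ Metric.ball 0 β) :
    RobinShell.firstEigenvalue h (RobinShell.shell β α x₀) x₀ α ≤
        RobinShell.firstEigenvalue h (RobinShell.shell β α (0 : EuclideanSpace ℝ (Fin N))) 0 α ∧
      (RobinShell.firstEigenvalue h (RobinShell.shell β α x₀) x₀ α =
          RobinShell.firstEigenvalue h (RobinShell.shell β α (0 : EuclideanSpace ℝ (Fin N))) 0 α ↔
        x₀ = 0) := by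
  by_cases hne : x₀ = 0
  · subst hne
    exact ⟨le_rfl, by simp⟩
  obtain ⟨τ, f, p, hτ, hsol, hnn, hbc, htop, hlb⟩ :=
    RobinShell.exists_radial_eigenfunction hN hα hαβ hh
  obtain ⟨q, hq, hqτ⟩ :=
    RobinShell.exists_rayleighValue_lt hN hα hαβ hx₀ hne hτ hsol hnn hbc htop
  have hlt : RobinShell.firstEigenvalue h (RobinShell.shell β α x₀) x₀ α <
      RobinShell.firstEigenvalue h
        (RobinShell.shell β α (0 : EuclideanSpace ℝ (Fin N))) 0 α := by
    refine lt_of_le_of_lt (sInf_le ⟨q, hq, rfl⟩)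
      (lt_of_lt_of_le (EReal.coe_lt_coe_iff.2 hqτ) (le_sInf ?_))
    rintro _ ⟨q', hq', rfl⟩
    exact EReal.coe_le_coe_iff.2 (hlb q' hq')
  exact ⟨hlt.le, fun he => absurd he hlt.ne, fun h0 => absurd h0 hne⟩
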